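/- Let $G=\mathrm{SL}_3(\mathbb Z)$ and, for $i\neq j$ in $\{1,2,3\}$, let $E_{i,j}\in G$ be the elementary matrix with ones on the diagonal and in position $(i,j)$ and zeros elsewhere. Consider the Steinberg presentation of $G$ with the six generators $E_{i,j}$ and the relators $$[E_{i,j},E_{i,k}],\qquad [E_{j,i},E_{k,i}],\qquad [E_{i,j},E_{j,k}]\,E_{i,k}^{-1}$$ for all ordered triples $(i,j,k)$ of distinct indices, where $[a,b]=aba^{-1}b^{-1}$, together with $$(E_{1,2}E_{2,1}^{-1}E_{1,2})^4 .$$ Let $S$ be the set of generators and $R$ the set of relators. Let $*$ be the involution $(\sum_g a_g g)^*=\sum_g a_g g^{-1}$ of the real group ring $\mathbb RG$, and for matrices over $\mathbb RG$ let $M^*$ be the transpose of $M$ with $*$ applied to every entry. Let $\partial/\partial s$ ($s\in S$) be the Fox derivatives, defined on the free group $F(S)$ with values in $\mathbb RF(S)$ by $\partial e/\partial s=0$, $\partial t/\partial s=\delta_{s,t}$ for $t\in S$, and $\partial(uv)/\partial s=\partial u/\partial s+u\,\partial v/\partial s$. Put $$d_0=\bigl[1-s\bigr]_{s\in S},\qquad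 d_1=\Bigl[\frac{\partial r}{\partial s}\Bigr]_{r\in R,\,s\in S},$$ a column over $\mathbb RG$ and a matrix over $\mathbb RG$ (the Fox derivatives being mapped to $\mathbb RG$), and let $$\Delta_1=d_0d_0^*+d_1^*d_1\in \mathrm{Mat}_6(\mathbb RG)$$ be the cohomological Laplacian in degree one. Then $\Delta_1-0.32\,I_6$ is a sum of hermitian squares: there are $k\in\mathbb N$ and $M_1,\dots,M_k\in\mathrm{Mat}_6(\mathbb RG)$ with $$\Delta_1-0.32\,I_6=\sum_{i=1}^k M_i^*M_i .$$ -/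

import Mathlib

open scoped Matrix commutatorElement

noncomputable section

/-! ## The real group ring as a `*`-ring -/

section GroupRing

variable {G : Type*} [Group G]

/-- The standard involution of the real group ring,
`(∑ a_g g)^* = ∑ a_g g⁻¹`. -/
instance realGroupRingStar : Star (MonoidAlgebra ℝ G) where
  star x := MonoidAlgebra.mapDomain (fun g : G => g⁻¹) x

theorem realGroupRing_star_single (g : G) (a : ℝ) :
    star (MonoidAlgebra.single g a) = MonoidAlgebra.single g⁻¹ a := by
  change MonoidAlgebra.mapDomain _ _ = _
  simp

theorem realGroupRing_star_add (x y : MonoidAlgebra ℝ G) :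
    star (x + y) = star x + star y := by
  change MonoidAlgebra.mapDomain _ _ = MonoidAlgebra.mapDomain _ _ + MonoidAlgebra.mapDomain _ _
  exact MonoidAlgebra.mapDomain_add _ _ _

instance realGroupRingStarRing : StarRing (MonoidAlgebra ℝ G) where
  star_add := realGroupRing_star_add
  star_involutive x := by
    induction x using MonoidAlgebra.induction_linear with
    | zero => exact (by change MonoidAlgebra.mapDomain _ (MonoidAlgebra.mapDomain _ _) = _; simp)
    | add x y hx hy => rw [realGroupRing_star_add, realGroupRing_star_add, hx, hy]
    | single g a => simp [realGroupRing_star_single]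
  star_mul x y := by
    have h0 : star (0 : MonoidAlgebra ℝ G) = 0 := by
      change MonoidAlgebra.mapDomain _ _ = _
      simp
    induction x using MonoidAlgebra.induction_linear with
    | zero => simp [h0]
    | add x x' hx hx' => rw [add_mul, realGroupRing_star_add, realGroupRing_star_add, mul_add, hx, hx']
    | single g a =>
      induction y using MonoidAlgebra.induction_linear with
      | zero => simp [h0]
      | add y y' hy hy' =>
        rw [mul_add, realGroupRing_star_add, realGroupRing_star_add, add_mul, hy, hy']
      | single h b =>
        simp [realGroupRing_star_single, MonoidAlgebra.single_mul_single, mul_comm]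

/-- `A` is a sum of hermitian squares in `Mat_n(ℝG)`: `A = ∑ M_i^* M_i` (a finite sum), where
`M^*` is the conjugate transpose of `M` with respect to the involution of `ℝG`. -/
def IsSumOfHermitianSquares {n : Type*} [Fintype n] (A : Matrix n n (MonoidAlgebra ℝ G)) : Prop :=
  ∃ (k : ℕ) (M : Fin k → Matrix n n (MonoidAlgebra ℝ G)), A = ∑ i, (M i)ᴴ * M i

end GroupRing

/-! ## Fox calculus -/

section Fox

variable {S : Type*} [DecidableEq S]

/-- The Fox derivative `∂w/∂s` of a word `w` in the letters `S ⊔ S⁻¹` (the letter `(t, true)`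
stands for `t` and `(t, false)` for `t⁻¹`), computed letter by letter with
`∂(uv)/∂s = ∂u/∂s + u ∂v/∂s`, `∂t/∂s = δ_{st}` and `∂(t⁻¹)/∂s = -δ_{st} t⁻¹`. -/
def foxWord (s : S) : List (S × Bool) → MonoidAlgebra ℝ (FreeGroup S)
  | [] => 0
  | (t, true) :: w =>
      (if t = s then 1 else 0) + MonoidAlgebra.of ℝ _ (FreeGroup.of t) * foxWord s w
  | (t, false) :: w =>
      -(if t = s then MonoidAlgebra.of ℝ _ (FreeGroup.of t)⁻¹ else 0) +
        MonoidAlgebra.of ℝ _ (FreeGroup.of t)⁻¹ * foxWord s w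

theorem foxWord_append (s : S) (u v : List (S × Bool)) :
    foxWord s (u ++ v) =
      foxWord s u + MonoidAlgebra.of ℝ _ (FreeGroup.mk u) * foxWord s v := by
  induction u with
  | nil => rw [← FreeGroup.one_eq_mk, map_one, one_mul, foxWord, zero_add, List.nil_append]
  | cons p u ih =>
    obtain ⟨t, b⟩ := p
    have hmk : (FreeGroup.mk ((t, b) :: u) : FreeGroup S) =
        FreeGroup.mk [(t, b)] * FreeGroup.mk u := by simp
    cases b
    · have h1 : (FreeGroup.mk [(t, false)] : FreeGroup S) = (FreeGroup.of t)⁻¹ := rfl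
      rw [hmk, h1, map_mul, List.cons_append, foxWord, foxWord, ih]
      simp only [mul_add, mul_assoc, add_assoc]
    · have h1 : (FreeGroup.mk [(t, true)] : FreeGroup S) = FreeGroup.of t := rfl
      rw [hmk, h1, map_mul, List.cons_append, foxWord, foxWord, ih]
      simp only [mul_add, mul_assoc, add_assoc]

theorem foxWord_step (s : S) (u v : List (S × Bool)) (h : FreeGroup.Red.Step u v) :
    foxWord s u = foxWord s v := by
  cases h with
  | @not L₁ L₂ t b =>
    rw [foxWord_append, foxWord_append]
    congr 2
    have h1 : MonoidAlgebra.of ℝ (FreeGroup S) (FreeGroup.of t) *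
        MonoidAlgebra.of ℝ _ (FreeGroup.of t)⁻¹ = 1 := by
      rw [← map_mul, mul_inv_cancel, map_one]
    have h2 : MonoidAlgebra.of ℝ (FreeGroup S) (FreeGroup.of t)⁻¹ *
        MonoidAlgebra.of ℝ _ (FreeGroup.of t) = 1 := by
      rw [← map_mul, inv_mul_cancel, map_one]
    cases b
    · simp only [Bool.not_false, foxWord, mul_add, ← mul_assoc, h2, one_mul]
      split_ifs <;> simp
    · simp only [Bool.not_true, foxWord, mul_add, ← mul_assoc, h1, one_mul]
      split_ifs
      · rw [mul_neg, h1]; simp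
      · simp

/-- The Fox derivative `∂x/∂s ∈ ℝF(S)` of an element `x` of the free group `F(S)`. -/
def foxDeriv (s : S) (x : FreeGroup S) : MonoidAlgebra ℝ (FreeGroup S) :=
  Quot.lift (foxWord s) (foxWord_step s) x

/-- The three defining formulas of the Fox derivatives. -/
theorem foxDeriv_one (s : S) : foxDeriv s (1 : FreeGroup S) = 0 := rfl

theorem foxDeriv_of (s t : S) : foxDeriv s (FreeGroup.of t) = if t = s then 1 else 0 := by
  change foxWord s [(t, true)] = _
  simp [foxWord]

theorem foxDeriv_mul (s : S) (x y : FreeGroup S) :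
    foxDeriv s (x * y) = foxDeriv s x + MonoidAlgebra.of ℝ _ x * foxDeriv s y := by
  induction x using Quot.inductionOn with
  | _ u =>
    induction y using Quot.inductionOn with
    | _ v => exact foxWord_append s u v

end Fox

/-! ## The cohomological Laplacian in degree one -/

section Laplacian

variable {G S R : Type*} [Group G] [DecidableEq S]

/-- For a group `G` with generators `gen s` (`s ∈ S`), the column
`d₀ = [1 - s]_{s ∈ S}` over `ℝG`. -/
def coboundaryZero (gen : S → G) : Matrix S Unit (MonoidAlgebra ℝ G) :=
  Matrix.of fun s _ => 1 - MonoidAlgebra.of ℝ G (gen s)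

/-- The Jacobian `d₁ = [∂r/∂s]_{r ∈ R, s ∈ S}` of the relators `rel r`; the Fox derivatives are
mapped from `ℝF(S)` to `ℝG`. -/
def coboundaryOne (gen : S → G) (rel : R → FreeGroup S) : Matrix R S (MonoidAlgebra ℝ G) :=
  Matrix.of fun r s =>
    MonoidAlgebra.mapDomainRingHom ℝ (FreeGroup.lift gen) (foxDeriv s (rel r))

/-- The cohomological Laplacian `Δ₁ = d₀ d₀^* + d₁^* d₁` of the presentation. -/
def cohomologicalLaplacianOne [Fintype R] (gen : S → G) (rel : R → FreeGroup S) :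
    Matrix S S (MonoidAlgebra ℝ G) :=
  coboundaryZero gen * (coboundaryZero gen)ᴴ + (coboundaryOne gen rel)ᴴ * coboundaryOne gen rel

end Laplacian

/-! ## The Steinberg presentation of `SL₃(ℤ)` -/

/-- The index set of the generators: ordered pairs `(i, j)` with `i ≠ j`. -/
abbrev ElementaryIndex : Type := {p : Fin 3 × Fin 3 // p.1 ≠ p.2}

theorem card_elementaryIndex : Fintype.card ElementaryIndex = 6 := by decide

/-- The elementary matrix `E_{i,j} = I + δ_{i,j} ∈ SL₃(ℤ)`. -/
def elementarySL3 (p : ElementaryIndex) : Matrix.SpecialLinearGroup (Fin 3) ℤ :=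
  Matrix.SpecialLinearGroup.transvection p.2 1

/-- Ordered triples `(i, j, k)` of distinct indices. -/
abbrev DistinctTriple : Type :=
  {t : Fin 3 × Fin 3 × Fin 3 // t.1 ≠ t.2.1 ∧ t.1 ≠ t.2.2 ∧ t.2.1 ≠ t.2.2}

/-- The generator `E_{i,j}` as a letter of the free group. -/
def elementaryLetter (i j : Fin 3) (h : i ≠ j) : FreeGroup ElementaryIndex :=
  FreeGroup.of ⟨(i, j), h⟩

/-- The index set of the relators: three families indexed by the triples `(i, j, k)` of distinct
indices, and one more relator. -/
inductive SteinbergIndex : Type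
  | row (t : DistinctTriple)
  | column (t : DistinctTriple)
  | mixed (t : DistinctTriple)
  | torsion
  deriving DecidableEq, Fintype

/-- The relators `[E_{i,j}, E_{i,k}]`, `[E_{j,i}, E_{k,i}]`, `[E_{i,j}, E_{j,k}] E_{i,k}⁻¹` and
`(E_{1,2} E_{2,1}⁻¹ E_{1,2})⁴`, where `[a, b] = a b a⁻¹ b⁻¹`. The indices `1, 2, 3` are the
elements `0, 1, 2` of `Fin 3`. -/
def steinbergRelator : SteinbergIndex → FreeGroup ElementaryIndex
  | .row ⟨(i, j, k), h⟩ =>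
      ⁅elementaryLetter i j h.1, elementaryLetter i k h.2.1⁆
  | .column ⟨(i, j, k), h⟩ =>
      ⁅elementaryLetter j i h.1.symm, elementaryLetter k i h.2.1.symm⁆
  | .mixed ⟨(i, j, k), h⟩ =>
      ⁅elementaryLetter i j h.1, elementaryLetter j k h.2.2⁆ * (elementaryLetter i k h.2.1)⁻¹
  | .torsion =>
      (elementaryLetter 0 1 (by decide) * (elementaryLetter 1 0 (by decide))⁻¹ *
        elementaryLetter 0 1 (by decide)) ^ 4

/-- The relators hold in `SL₃(ℤ)`. -/
theorem lift_steinbergRelator (r : SteinbergIndex) :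
    FreeGroup.lift elementarySL3 (steinbergRelator r) = 1 := by
  cases r with
  | row t =>
    revert t
    simp only [Subtype.forall, Prod.forall, steinbergRelator, elementaryLetter,
      commutatorElement_def, map_mul, map_inv, FreeGroup.lift_apply_of, elementarySL3]
    decide
  | column t =>
    revert t
    simp only [Subtype.forall, Prod.forall, steinbergRelator, elementaryLetter,
      commutatorElement_def, map_mul, map_inv, FreeGroup.lift_apply_of, elementarySL3]
    decide
  | mixed t =>
    revert t
    simp only [Subtype.forall, Prod.forall, steinbergRelator, elementaryLetter,
      commutatorElement_def, map_mul, map_inv, FreeGroup.lift_apply_of, elementarySL3]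
    decide
  | torsion =>
    simp only [steinbergRelator, elementaryLetter, map_pow,
      map_mul, map_inv, FreeGroup.lift_apply_of, elementarySL3]
    decide

/-- The cohomological Laplacian `Δ₁ ∈ Mat₆(ℝ SL₃(ℤ))` of the Steinberg presentation. -/
def steinbergLaplacian :
    Matrix ElementaryIndex ElementaryIndex
      (MonoidAlgebra ℝ (Matrix.SpecialLinearGroup (Fin 3) ℤ)) :=
  cohomologicalLaplacianOne elementarySL3 steinbergRelator

end

/-! ## The cone of sums of hermitian squares -/

section Cone

variable {G : Type*} [Group G]

theorem star_single_realGroupRing (g : G) :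
    star (MonoidAlgebra.of ℝ G g) = MonoidAlgebra.of ℝ G g⁻¹ :=
  realGroupRing_star_single g 1

instance realGroupRingStarModule : StarModule ℝ (MonoidAlgebra ℝ G) where
  star_smul c x := by
    induction x using MonoidAlgebra.induction_linear with
    | zero => simp
    | add x y hx hy => rw [smul_add, star_add, hx, hy, star_add, smul_add]
    | single g a =>
      rw [MonoidAlgebra.smul_single, realGroupRing_star_single, realGroupRing_star_single,
        MonoidAlgebra.smul_single]
      simp

namespace IsSumOfHermitianSquares

variable {n : Type*} [Fintype n] {A B : Matrix n n (MonoidAlgebra ℝ G)}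

theorem zero : IsSumOfHermitianSquares (0 : Matrix n n (MonoidAlgebra ℝ G)) :=
  ⟨0, Fin.elim0, by simp⟩

theorem conjTranspose_mul_self (M : Matrix n n (MonoidAlgebra ℝ G)) :
    IsSumOfHermitianSquares (Mᴴ * M) :=
  ⟨1, fun _ => M, by simp⟩

theorem add (hA : IsSumOfHermitianSquares A) (hB : IsSumOfHermitianSquares B) :
    IsSumOfHermitianSquares (A + B) := by
  obtain ⟨k, M, rfl⟩ := hA
  obtain ⟨l, N, rfl⟩ := hB
  exact ⟨k + l, Fin.append M N, by simp [Fin.sum_univ_add]⟩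

theorem smul {c : ℝ} (hc : 0 ≤ c) (hA : IsSumOfHermitianSquares A) :
    IsSumOfHermitianSquares (c • A) := by
  obtain ⟨k, M, rfl⟩ := hA
  refine ⟨k, fun i => √c • M i, ?_⟩
  simp [Matrix.conjTranspose_smul, Finset.smul_sum, smul_smul, Real.mul_self_sqrt hc]

theorem sum {ι : Type*} (s : Finset ι) {f : ι → Matrix n n (MonoidAlgebra ℝ G)}
    (h : ∀ i ∈ s, IsSumOfHermitianSquares (f i)) : IsSumOfHermitianSquares (∑ i ∈ s, f i) := by
  classical
  induction s using Finset.induction_on with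
  | empty => simpa using zero
  | insert a s ha ih =>
    rw [Finset.sum_insert ha]
    exact (h a (by simp)).add (ih fun i hi => h i (by simp [hi]))

theorem conjTranspose_mul_self_of_rect [Nonempty n] {m : Type*} [Fintype m]
    (X : Matrix m n (MonoidAlgebra ℝ G)) : IsSumOfHermitianSquares (Xᴴ * X) := by
  classical
  obtain ⟨i₀⟩ := ‹Nonempty n›
  have h : Xᴴ * X = ∑ r, (Matrix.of fun i j => if i = i₀ then X r j else 0)ᴴ *
      (Matrix.of fun i j => if i = i₀ then X r j else 0) := by
    ext p q
    simp [Matrix.sum_apply, Matrix.mul_apply, apply_ite star]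
  rw [h]
  exact sum _ fun r _ => conjTranspose_mul_self _

theorem submatrix {m : Type*} [Fintype m] (e : m ≃ n) (hA : IsSumOfHermitianSquares A) :
    IsSumOfHermitianSquares (A.submatrix e e) := by
  obtain ⟨k, M, rfl⟩ := hA
  refine ⟨k, fun i => (M i).submatrix e e, ?_⟩
  ext p q : 1
  simp only [Matrix.submatrix_apply, Matrix.sum_apply, Matrix.mul_apply, Matrix.conjTranspose_apply]
  exact Finset.sum_congr rfl fun i _ => (e.sum_comp fun j => star (M i j (e p)) * M i j (e q)).symm

/-- A unitary `U` satisfies `U + U^* + 2 ≥ 0` and `-(U + U^*) + 2 ≥ 0`. -/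
theorem smul_add_conjTranspose [DecidableEq n] {U : Matrix n n (MonoidAlgebra ℝ G)}
    (hU : Uᴴ * U = 1) (c : ℝ) :
    IsSumOfHermitianSquares (c • U + (c • U)ᴴ + (2 * |c|) • 1) := by
  rcases le_total 0 c with hc | hc
  · have h : c • U + (c • U)ᴴ + (2 * |c|) • 1 = c • ((1 + U)ᴴ * (1 + U)) := by
      rw [abs_of_nonneg hc, Matrix.conjTranspose_add, add_mul, mul_add, mul_add, hU,
        Matrix.conjTranspose_smul, star_trivial, Matrix.conjTranspose_one, mul_one, one_mul, mul_one]
      module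
    rw [h]
    exact (conjTranspose_mul_self _).smul hc
  · have h : c • U + (c • U)ᴴ + (2 * |c|) • 1 = (-c) • ((1 - U)ᴴ * (1 - U)) := by
      rw [abs_of_nonpos hc, Matrix.conjTranspose_sub, sub_mul, mul_sub, mul_sub, hU,
        Matrix.conjTranspose_smul, star_trivial, Matrix.conjTranspose_one, mul_one, one_mul, mul_one]
      module
    rw [h]
    exact (conjTranspose_mul_self _).smul (neg_nonneg.2 hc)

end IsSumOfHermitianSquares

end Cone

/-! ## A semidirect product as unitary matrices over the group ring -/

section Crossed

variable {G P : Type*} [Group G] [Group P] [Fintype P] [DecidableEq P] (φ : P →* MulAut G)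

/-- The semidirect product `G ⋊ P` acts by monomial matrices over `ℝG` with rows and columns
indexed by `P`. -/
noncomputable def crossedUnit : G ⋊[φ] P →* Matrix P P (MonoidAlgebra ℝ G) where
  toFun γ := Matrix.of fun τ τ' =>
    if τ' = τ * γ.right then MonoidAlgebra.of ℝ G (φ τ γ.left) else 0
  map_one' := by
    ext τ τ' : 1
    simp [Matrix.one_apply, eq_comm, MonoidAlgebra.one_def]
  map_mul' γ δ := by
    ext τ τ' : 1
    rw [Matrix.mul_apply, Finset.sum_eq_single (τ * γ.right) (fun τ'' _ h => by simp [h])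
      (fun h => absurd (Finset.mem_univ _) h)]
    simp only [Matrix.of_apply, if_true, mul_ite, mul_zero, ← map_mul, mul_assoc,
      SemidirectProduct.mul_right, SemidirectProduct.mul_left]
    simp only [map_mul, MulAut.mul_apply]

theorem crossedUnit_apply (γ : G ⋊[φ] P) (τ τ' : P) :
    crossedUnit φ γ τ τ' =
      if τ' = τ * γ.right then MonoidAlgebra.of ℝ G (φ τ γ.left) else 0 := rfl

theorem conjTranspose_crossedUnit (γ : G ⋊[φ] P) :
    (crossedUnit φ γ)ᴴ = crossedUnit φ γ⁻¹ := by
  ext τ τ' : 1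
  rw [Matrix.conjTranspose_apply, crossedUnit_apply, crossedUnit_apply, apply_ite star, star_zero,
    star_single_realGroupRing]
  by_cases h : τ = τ' * γ.right
  · subst h
    simp only [SemidirectProduct.inv_right, SemidirectProduct.inv_left, mul_inv_cancel_right,
      if_true, map_mul, MulAut.mul_apply, map_inv, MulAut.apply_inv_self]
  · rw [if_neg h, if_neg]
    rintro rfl
    simp at h

theorem conjTranspose_crossedUnit_mul_self (γ : G ⋊[φ] P) :
    (crossedUnit φ γ)ᴴ * crossedUnit φ γ = 1 := by
  rw [conjTranspose_crossedUnit, ← map_mul, inv_mul_cancel, map_one]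

/-- The standard scalar product of two integer vectors given as lists. -/
def listDot : List ℤ → List ℤ → ℤ
  | a :: l, b :: m => a * b + listDot l m
  | _, _ => 0

theorem listDot_eq_sum (l m : List ℤ) (h : l.length = m.length) :
    listDot l m = ∑ r ∈ Finset.range l.length, l.getD r 0 * m.getD r 0 := by
  induction l generalizing m with
  | nil => simp [listDot]
  | cons a l ih =>
    cases m with
    | nil => simp at h
    | cons b m =>
      rw [listDot, ih m (by simpa using h), List.length_cons, Finset.sum_range_succ']
      simp [add_comm]

theorem listDot_append (l₁ m₁ l₂ m₂ : List ℤ) (h : l₁.length = m₁.length) :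
    listDot (l₁ ++ l₂) (m₁ ++ m₂) = listDot l₁ m₁ + listDot l₂ m₂ := by
  induction l₁ generalizing m₁ with
  | nil => cases m₁ <;> simp_all [listDot]
  | cons a l ih =>
    cases m₁ with
    | nil => simp at h
    | cons b m => simp [listDot, ih m (by simpa using h), add_assoc]

theorem listDot_neg (l m : List ℤ) : listDot l (m.map (- ·)) = -listDot l m := by
  induction l generalizing m with
  | nil => simp [listDot]
  | cons a l ih => cases m <;> simp_all [listDot]; ring

theorem listDot_neg_neg (l m : List ℤ) :
    listDot (l.map (- ·)) (m.map (- ·)) = listDot l m := by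
  induction l generalizing m with
  | nil => simp [listDot]
  | cons a l ih => cases m <;> simp_all [listDot]

/-- The element `b⁻¹ s c` of the semidirect product. -/
def sandwich (b : G) (s : P) (c : G) : G ⋊[φ] P :=
  (SemidirectProduct.inl b)⁻¹ * SemidirectProduct.inr s * SemidirectProduct.inl c

omit [Fintype P] [DecidableEq P] in
theorem sandwich_eq (b : G) (s : P) (c : G) : sandwich φ b s c = ⟨b⁻¹ * φ s c, s⟩ := by
  ext <;> simp [sandwich]

theorem conjTranspose_mul_self_sum_crossedUnit {ι : Type*} [Fintype ι] (c : ι → ℝ)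
    (γ : ι → G ⋊[φ] P) :
    (∑ q, c q • crossedUnit φ (γ q))ᴴ * (∑ q, c q • crossedUnit φ (γ q)) =
      ∑ q, ∑ q', (c q * c q') • crossedUnit φ ((γ q)⁻¹ * γ q') := by
  rw [Matrix.conjTranspose_sum, Finset.sum_mul_sum]
  refine Finset.sum_congr rfl fun q _ => Finset.sum_congr rfl fun q' _ => ?_
  rw [Matrix.conjTranspose_smul, star_trivial, conjTranspose_crossedUnit, smul_mul_smul_comm,
    map_mul]

omit [Group P] [DecidableEq P] in
theorem sum_rearrange {K R M : Type*} [Fintype K] [AddCommMonoid M] (t : Finset R)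
    (f : P → K → K → P → R → M) :
    ∑ s, ∑ i, ∑ j, ∑ σ, ∑ r ∈ t, f s i j σ r = ∑ r ∈ t, ∑ σ, ∑ i, ∑ s, ∑ j, f s i j σ r := by
  calc _ = ∑ q : P × K × K × P, ∑ r ∈ t, f q.1 q.2.1 q.2.2.1 q.2.2.2 r := by
        simp only [Fintype.sum_prod_type]
    _ = ∑ r ∈ t, ∑ q : P × K × K × P, f q.1 q.2.1 q.2.2.1 q.2.2.2 r := Finset.sum_comm
    _ = ∑ r ∈ t, ∑ q : P × K × P × K, f q.2.2.1 q.2.1 q.2.2.2 q.1 r :=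
        Finset.sum_congr rfl fun r _ => Fintype.sum_equiv
          ⟨fun q => (q.2.2.2, q.2.1, q.1, q.2.2.1), fun q => (q.2.2.1, q.2.1, q.2.2.2, q.1),
            fun _ => rfl, fun _ => rfl⟩ _ _ fun _ => rfl
    _ = _ := by simp only [Fintype.sum_prod_type]

theorem sum_listDot_smul_eq {K : Type*} [Fintype K] (b : K → G) (z : P → K → List ℤ) (N : ℕ)
    (hz : ∀ σ i, (z σ i).length = N) :
    ∑ s : P, ∑ i, ∑ j, ((∑ σ, listDot (z σ i) (z (σ * s) j) : ℤ) : ℝ) •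
        crossedUnit φ (sandwich φ (b i) s (b j)) =
      ∑ r ∈ Finset.range N,
        (∑ q : P × K, (((z q.1 q.2).getD r 0 : ℤ) : ℝ) •
          crossedUnit φ (SemidirectProduct.inr q.1 * SemidirectProduct.inl (b q.2)))ᴴ *
        (∑ q : P × K, (((z q.1 q.2).getD r 0 : ℤ) : ℝ) •
          crossedUnit φ (SemidirectProduct.inr q.1 * SemidirectProduct.inl (b q.2))) := by
  have h2 : ∀ (σ s : P) (i j : K),
      (SemidirectProduct.inr σ * SemidirectProduct.inl (b i) : G ⋊[φ] P)⁻¹ *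
          (SemidirectProduct.inr (σ * s) * SemidirectProduct.inl (b j)) =
        sandwich φ (b i) s (b j) := by
    intro σ s i j
    rw [sandwich, map_mul]; group
  simp only [conjTranspose_mul_self_sum_crossedUnit]
  simp only [Fintype.sum_prod_type]
  calc _ = ∑ s : P, ∑ i, ∑ j, ∑ σ, ∑ r ∈ Finset.range N,
        (((z σ i).getD r 0 : ℝ) * ((z (σ * s) j).getD r 0 : ℝ)) •
          crossedUnit φ (sandwich φ (b i) s (b j)) := by
        refine Finset.sum_congr rfl fun s _ => Finset.sum_congr rfl fun i _ =>
          Finset.sum_congr rfl fun j _ => ?_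
        rw [Int.cast_sum, Finset.sum_smul]
        refine Finset.sum_congr rfl fun σ _ => ?_
        rw [listDot_eq_sum _ _ (by rw [hz, hz]), hz, Int.cast_sum, Finset.sum_smul]
        simp only [Int.cast_mul]
    _ = ∑ r ∈ Finset.range N, ∑ σ, ∑ i, ∑ s : P, ∑ j,
        (((z σ i).getD r 0 : ℝ) * ((z (σ * s) j).getD r 0 : ℝ)) •
          crossedUnit φ (sandwich φ (b i) s (b j)) := by
        exact sum_rearrange _ _
    _ = _ := by
        refine Finset.sum_congr rfl fun r _ => Finset.sum_congr rfl fun σ _ =>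
          Finset.sum_congr rfl fun i _ => ?_
        refine Eq.trans ?_ (Equiv.sum_comp (Equiv.mulLeft σ) _)
        refine Finset.sum_congr rfl fun s _ => Finset.sum_congr rfl fun j _ => ?_
        rw [Equiv.coe_mulLeft, h2]

theorem isSumOfHermitianSquares_gram {I : Type*} (b : I → G) (z : P → I → List ℤ) (N : ℕ)
    (hz : ∀ σ i, (z σ i).length = N) (l : List I) :
    IsSumOfHermitianSquares (∑ s : P, (l.map fun i => (l.map fun j =>
      ((∑ σ, listDot (z σ i) (z (σ * s) j) : ℤ) : ℝ) •
        crossedUnit φ (sandwich φ (b i) s (b j))).sum).sum) := by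
  have hsum : ∀ f : I → Matrix P P (MonoidAlgebra ℝ G),
      (l.map f).sum = ∑ k : Fin l.length, f (l.get k) := fun f => by
    rw [← List.sum_ofFn]
    congr 1
    exact (List.ofFn_getElem_eq_map l f).symm
  simp only [hsum]
  rw [sum_listDot_smul_eq φ (fun k => b (l.get k)) (fun σ k => z σ (l.get k)) N
    fun σ k => hz σ _]
  exact .sum _ fun r _ => .conjTranspose_mul_self _

end Crossed

/-! ## Scalar products by one multiplication of natural numbers -/

section Packing

/-- The value at `X` of the polynomial with coefficients `l`, lowest coefficient first. -/
noncomputable def packLow (X : ℕ) (l : List ℕ) : ℕ :=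
  List.rec 0 (fun a _ ih => Nat.add a (Nat.mul X ih)) l

/-- The value at `X` of the polynomial with coefficients `l`, highest coefficient first. -/
noncomputable def packHigh (X : ℕ) (l : List ℕ) : ℕ :=
  List.rec (motive := fun _ => ℕ → ℕ) (fun acc => acc) (fun a _ ih acc => ih (Nat.add (Nat.mul acc X) a)) l 0

theorem packLow_cons (X a : ℕ) (l : List ℕ) : packLow X (a :: l) = a + X * packLow X l := rfl

theorem packHigh_cons (X a : ℕ) (l : List ℕ) :
    packHigh X (a :: l) = a * X ^ l.length + packHigh X l := by
  have h : ∀ (l : List ℕ) (acc : ℕ),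
      List.rec (motive := fun _ => ℕ → ℕ) (fun acc => acc)
        (fun a _ ih acc => ih (Nat.add (Nat.mul acc X) a)) l acc = acc * X ^ l.length + packHigh X l := by
    intro l
    induction l with
    | nil => intro acc; simp [packHigh]
    | cons a l ih =>
      intro acc
      change List.rec (motive := fun _ => ℕ → ℕ) _ _ l (Nat.add (Nat.mul acc X) a) = _ +
        List.rec (motive := fun _ => ℕ → ℕ) _ _ l (Nat.add (Nat.mul 0 X) a)
      rw [ih, ih, List.length_cons, Nat.add_eq, Nat.add_eq, Nat.mul_eq, Nat.mul_eq]
      ring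
  change List.rec (motive := fun _ => ℕ → ℕ) _ _ l (Nat.add (Nat.mul 0 X) a) = _
  rw [h, Nat.add_eq, Nat.mul_eq, zero_mul, zero_add]

/-- The standard scalar product of two lists of natural numbers. -/
def natDot : List ℕ → List ℕ → ℕ
  | a :: l, b :: m => a * b + natDot l m
  | _, _ => 0

variable {X B : ℕ}

theorem natDot_le (l m : List ℕ) (hl : ∀ a ∈ l, a ≤ B) (hm : ∀ a ∈ m, a ≤ B) :
    natDot l m ≤ l.length * B ^ 2 := by
  induction l generalizing m with
  | nil => simp [natDot]
  | cons a l ih =>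
    cases m with
    | nil => simp [natDot]
    | cons b m =>
      simp only [List.mem_cons, forall_eq_or_imp] at hl hm
      have h1 := ih m hl.2 hm.2
      have h2 := Nat.mul_le_mul hl.1 hm.1
      rw [natDot, List.length_cons]
      nlinarith

theorem packHigh_le (m : List ℕ) (hm : ∀ a ∈ m, a ≤ B) :
    X * packHigh (X + 1) m ≤ B * (X + 1) ^ m.length := by
  induction m with
  | nil => simp [packHigh]
  | cons b m ih =>
    simp only [List.mem_cons, forall_eq_or_imp] at hm
    have h1 := ih hm.2
    rw [packHigh_cons, List.length_cons, pow_succ]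
    have h2 := Nat.mul_le_mul_right (X * (X + 1) ^ m.length) hm.1
    linarith

theorem packLow_mul_packHigh (l m : List ℕ) (h : l.length = m.length)
    (hl : ∀ a ∈ l, a ≤ B) (hm : ∀ a ∈ m, a ≤ B) :
    ∃ hi lo, packLow (X + 1) l * packHigh (X + 1) m * (X + 1) =
        (hi * (X + 1) + natDot l m) * (X + 1) ^ l.length + lo ∧
      X * lo ≤ l.length * B ^ 2 * (X + 1) ^ l.length := by
  induction l generalizing m with
  | nil => exact ⟨0, 0, by simp [packLow, natDot]⟩
  | cons a l ih =>
    cases m with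
    | nil => simp at h
    | cons b m =>
      simp only [List.mem_cons, forall_eq_or_imp] at hl hm
      have hlen : l.length = m.length := by simpa using h
      obtain ⟨hi, lo, h1, h2⟩ := ih m hlen hl.2 hm.2
      have h3 := packHigh_le (X := X) m hm.2
      rw [← hlen] at h3
      refine ⟨hi + b * packLow (X + 1) l, (X + 1) * lo + a * packHigh (X + 1) m * (X + 1), ?_, ?_⟩
      · rw [packLow_cons, packHigh_cons, natDot, List.length_cons, ← hlen, pow_succ]
        linear_combination (X + 1) * h1
      · rw [List.length_cons, pow_succ]
        have h4 : X * (a * packHigh (X + 1) m) ≤ B * (B * (X + 1) ^ l.length) := by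
          calc X * (a * packHigh (X + 1) m) = a * (X * packHigh (X + 1) m) := by ring
            _ ≤ _ := Nat.mul_le_mul hl.1 h3
        have h5 := Nat.mul_le_mul_right (X + 1) (Nat.add_le_add h2 h4)
        calc _ = (X * lo + X * (a * packHigh (X + 1) m)) * (X + 1) := by ring
          _ ≤ _ := h5
          _ = _ := by ring

/-- The scalar product of two vectors is the middle coefficient of a product of polynomials. -/
theorem packLow_mul_packHigh_div_mod {n : ℕ} (l m : List ℕ) (hl' : l.length = n + 1)
    (hm' : m.length = n + 1) (hl : ∀ a ∈ l, a ≤ B) (hm : ∀ a ∈ m, a ≤ B)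
    (hX : (n + 1) * B ^ 2 + 1 < X) :
    packLow X l * packHigh X m / X ^ n % X = natDot l m := by
  obtain ⟨X, rfl⟩ : ∃ Y, X = Y + 1 := ⟨X - 1, by omega⟩
  replace hX := Nat.lt_of_add_lt_add_right hX
  obtain ⟨hi, lo, h1, h2⟩ := packLow_mul_packHigh (X := X) l m (hl'.trans hm'.symm) hl hm
  rw [hl'] at h1 h2
  have hpos : 0 < (X + 1) ^ (n + 1) := by positivity
  have h3 : lo < (X + 1) ^ (n + 1) := by
    by_contra hc
    have h4 := Nat.mul_le_mul_left X (not_lt.1 hc)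
    have h5 := Nat.mul_lt_mul_of_pos_right hX hpos
    omega
  have h4 := natDot_le l m hl hm
  rw [hl'] at h4
  rw [← Nat.mul_div_mul_right _ _ (Nat.succ_pos X), Nat.succ_eq_add_one, ← pow_succ, h1,
    mul_comm _ ((X + 1) ^ (n + 1)), Nat.mul_add_div hpos, Nat.div_eq_of_lt h3, add_zero,
    Nat.mul_add_mod_self_right, Nat.mod_eq_of_lt (by omega)]

/-- Integer vectors are stored with an offset. -/
def shiftList (K : ℤ) (l : List ℕ) : List ℤ := l.map fun a : ℕ => (a : ℤ) - K

theorem listDot_shiftList (K : ℤ) (l m : List ℕ) (h : l.length = m.length) :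
    listDot (shiftList K l) (shiftList K m) =
      natDot l m + l.length * K ^ 2 - (K * l.sum + K * m.sum) := by
  induction l generalizing m with
  | nil => cases m <;> simp_all [listDot, natDot, shiftList]
  | cons a l ih =>
    cases m with
    | nil => simp at h
    | cons b m =>
      have h1 := ih m (by simpa using h)
      simp only [shiftList] at h1
      simp only [shiftList, List.map_cons, listDot, h1, natDot, List.sum_cons, List.length_cons]
      push_cast
      ring

end Packing

theorem List.neg_sum_map {I M : Type*} [AddCommGroup M] (m : List I) (f : I → M) :
    -(m.map f).sum = (m.map fun v => -f v).sum := by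
  induction m with
  | nil => simp
  | cons v m ih => rw [List.map_cons, List.sum_cons, neg_add, ih, List.map_cons, List.sum_cons]

/-! ## Collecting terms in a search tree -/

section Tree

/-- Binary search trees with integer values. -/
inductive TermTree
  | leaf
  | node (l : TermTree) (k : ℕ) (v : ℤ) (r : TermTree)

namespace TermTree

/-- Add the value `v` at the key `k`, and go on with `c`. -/
noncomputable def insert (t : TermTree) (k : ℕ) (v : ℤ) : (TermTree → Bool) → Bool :=
  TermTree.rec (motive := fun _ => (TermTree → Bool) → Bool)
    (fun c => c (.node .leaf k v .leaf))
    (fun l k' v' r ihl ihr c =>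
      Bool.rec
        (Bool.rec (ihr fun r' => c (.node l k' v' r')) (c (.node l k' (v' + v) r)) (Nat.ble k k'))
        (ihl fun l' => c (.node l' k' v' r))
        (Nat.ble (k + 1) k')) t

/-- The sum of the absolute values. -/
noncomputable def norm (t : TermTree) : ℕ :=
  TermTree.rec 0 (fun _ _ v _ ihl ihr => ihl + v.natAbs + ihr) t

variable {M : Type*} [AddCommGroup M] [Module ℝ M] (U : ℕ → M)

/-- The linear combination of the vectors `U k` with the values of the tree as coefficients. -/
noncomputable def eval : TermTree → M
  | leaf => 0
  | node l k v r => eval l + (v : ℝ) • U k + eval r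

theorem exists_of_insert (t : TermTree) (k : ℕ) (v : ℤ) (c : TermTree → Bool)
    (h : t.insert k v c = true) :
    ∃ t', c t' = true ∧ t'.eval U = t.eval U + (v : ℝ) • U k := by
  induction t generalizing c with
  | leaf => exact ⟨_, h, by simp [eval]⟩
  | node l k' v' r ihl ihr =>
    change Bool.rec (Bool.rec (r.insert k v _) _ _) (l.insert k v _) _ = true at h
    cases h1 : Nat.ble (k + 1) k' with
    | true =>
      rw [h1] at h
      obtain ⟨l', hc, hl⟩ := ihl _ h
      refine ⟨_, hc, ?_⟩
      simp only [eval, hl]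
      abel
    | false =>
      rw [h1] at h
      cases h2 : Nat.ble k k' with
      | true =>
        rw [h2] at h
        have hk : k = k' := by
          rw [← Bool.not_eq_true, Nat.ble_eq] at h1
          rw [Nat.ble_eq] at h2
          omega
        refine ⟨_, h, ?_⟩
        simp only [eval, hk, Int.cast_add, add_smul]
        abel
      | false =>
        rw [h2] at h
        obtain ⟨r', hc, hr⟩ := ihr _ h
        refine ⟨_, hc, ?_⟩
        simp only [eval, hr]
        abel

theorem isSumOfHermitianSquares_eval_add_norm {G n : Type*} [Group G] [Fintype n] [DecidableEq n]
    (U : ℕ → Matrix n n (MonoidAlgebra ℝ G)) (hU : ∀ k, (U k)ᴴ * U k = 1) (t : TermTree) :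
    IsSumOfHermitianSquares (t.eval U + (t.eval U)ᴴ + (2 * (t.norm : ℝ)) • 1) := by
  induction t with
  | leaf => simpa [eval, norm] using IsSumOfHermitianSquares.zero
  | node l k v r ihl ihr =>
    have h : (node l k v r).norm = l.norm + v.natAbs + r.norm := rfl
    have h1 := (ihl.add ihr).add (IsSumOfHermitianSquares.smul_add_conjTranspose (hU k) v)
    convert h1 using 1
    rw [h]
    push_cast
    simp only [eval, Matrix.conjTranspose_add, mul_add, add_smul, Nat.cast_natAbs, Int.cast_abs]
    abel

end TermTree

/-- Evaluate `n` to a numeral before going on with `c`. -/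
noncomputable def force (n : ℕ) (c : ℕ → Bool) : Bool := Nat.rec (c 0) (fun m _ => c (m + 1)) n

theorem force_eq (n : ℕ) (c : ℕ → Bool) : force n c = c n := by cases n <;> rfl

end Tree

/-! ## Permutation of coordinates on `SL₃(ℤ)` -/

section Conjugation

/-- Conjugation by a permutation matrix. -/
def permConj : Equiv.Perm (Fin 3) →* MulAut (Matrix.SpecialLinearGroup (Fin 3) ℤ) where
  toFun σ :=
    { toFun := fun g => ⟨g.1.submatrix ⇑σ⁻¹ ⇑σ⁻¹, by
        rw [Matrix.det_submatrix_equiv_self]; exact g.2⟩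
      invFun := fun g => ⟨g.1.submatrix ⇑σ ⇑σ, by
        rw [Matrix.det_submatrix_equiv_self]; exact g.2⟩
      left_inv := fun g => by ext i j; simp
      right_inv := fun g => by ext i j; simp
      map_mul' := fun g h => by
        ext i j
        exact congrFun (congrFun (Matrix.submatrix_mul_equiv g.1 h.1 ⇑σ⁻¹ σ⁻¹ ⇑σ⁻¹).symm i) j }
  map_one' := rfl
  map_mul' _ _ := rfl

end Conjugation

/-! ## Numerical keys of the elements of `SL₃(ℤ)` -/

section Key

/-- The adjugate of a matrix of size three. -/
def cofactors (g : Matrix (Fin 3) (Fin 3) ℤ) : Matrix (Fin 3) (Fin 3) ℤ :=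
  !![g 1 1 * g 2 2 - g 1 2 * g 2 1, g 0 2 * g 2 1 - g 0 1 * g 2 2, g 0 1 * g 1 2 - g 0 2 * g 1 1;
    g 1 2 * g 2 0 - g 1 0 * g 2 2, g 0 0 * g 2 2 - g 0 2 * g 2 0, g 0 2 * g 1 0 - g 0 0 * g 1 2;
    g 1 0 * g 2 1 - g 1 1 * g 2 0, g 0 1 * g 2 0 - g 0 0 * g 2 1, g 0 0 * g 1 1 - g 0 1 * g 1 0]

theorem cofactors_eq (g : Matrix (Fin 3) (Fin 3) ℤ) : cofactors g = g.adjugate := by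
  rw [Matrix.adjugate_fin_three, cofactors]
  ext i j
  fin_cases i <;> fin_cases j <;> simp <;> ring

/-- A matrix of determinant one such that its entries and those of its inverse are at most two. -/
def IsSmall (g : Matrix (Fin 3) (Fin 3) ℤ) : Prop :=
  (g 0 0 * cofactors g 0 0 + g 0 1 * cofactors g 1 0 + g 0 2 * cofactors g 2 0 = 1) ∧
    ∀ i j, -2 ≤ g i j ∧ g i j ≤ 2 ∧ -2 ≤ cofactors g i j ∧ cofactors g i j ≤ 2

instance (g : Matrix (Fin 3) (Fin 3) ℤ) : Decidable (IsSmall g) := by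
  have (i : Fin 3) : Decidable
      (∀ j, -2 ≤ g i j ∧ g i j ≤ 2 ∧ -2 ≤ cofactors g i j ∧ cofactors g i j ≤ 2) :=
    Nat.decidableForallFin _
  exact instDecidableAnd (dq := Nat.decidableForallFin _)

theorem IsSmall.det_eq {g : Matrix (Fin 3) (Fin 3) ℤ} (h : IsSmall g) : g.det = 1 := by
  rw [← h.1, Matrix.det_fin_three, cofactors]
  simp
  ring

open Classical in
/-- The element of `SL₃(ℤ)` with a given matrix. -/
noncomputable def toSL (g : Matrix (Fin 3) (Fin 3) ℤ) : Matrix.SpecialLinearGroup (Fin 3) ℤ :=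
  if h : g.det = 1 then ⟨g, h⟩ else 1

theorem IsSmall.coe_toSL {g : Matrix (Fin 3) (Fin 3) ℤ} (h : IsSmall g) : (toSL g).1 = g := by
  exact congrArg Subtype.val (dif_pos h.det_eq)

theorem IsSmall.coe_inv_toSL {g : Matrix (Fin 3) (Fin 3) ℤ} (h : IsSmall g) :
    ((toSL g)⁻¹).1 = cofactors g := by
  rw [cofactors_eq]
  conv_rhs => rw [← h.coe_toSL]
  rfl

/-- Keys are residues modulo this power of two. -/
def keyModulus : ℕ := 2 ^ 45

/-- An invertible residue, which spreads the keys. -/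
def keyFactor : ℕ := 0x9E3779B97F5

/-- The residue of an integer. -/
def toKey (z : ℤ) : ℕ := (z % (keyModulus : ℤ)).toNat

theorem toKey_modEq (z : ℤ) : ((toKey z : ℕ) : ℤ) ≡ z [ZMOD keyModulus] := by
  rw [toKey, Int.toNat_of_nonneg (Int.emod_nonneg _ (by norm_num [keyModulus]))]
  exact Int.mod_modEq _ _

/-- A matrix with small entries as one integer. -/
def matrixCode (g : Matrix (Fin 3) (Fin 3) ℤ) : ℤ :=
  g 0 0 + 32 * g 1 0 + 32 ^ 2 * g 2 0 + 32 ^ 3 * (g 0 1 + 32 * g 1 1 + 32 ^ 2 * g 2 1) +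
    32 ^ 6 * (g 0 2 + 32 * g 1 2 + 32 ^ 2 * g 2 2)

theorem eq_of_matrixCode {g h : Matrix (Fin 3) (Fin 3) ℤ} {k : ℤ}
    (hg : ∀ i j, -12 ≤ g i j ∧ g i j ≤ 12) (hh : ∀ i j, -12 ≤ h i j ∧ h i j ≤ 12)
    (h1 : k ≡ keyFactor * matrixCode g [ZMOD keyModulus])
    (h2 : k ≡ keyFactor * matrixCode h [ZMOD keyModulus]) : g = h := by
  have h3 : (keyModulus : ℤ) ∣ keyFactor * (matrixCode h - matrixCode g) := by
    rw [mul_sub]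
    exact (h1.symm.trans h2).dvd
  have h4 : IsCoprime (keyModulus : ℤ) keyFactor :=
    IsCoprime.symm ⟨19285721160797, -(19285721160797 * keyFactor / keyModulus), by
      norm_num [keyFactor, keyModulus]⟩
  obtain ⟨c, hc⟩ := h4.dvd_of_dvd_mul_left h3
  have digit : ∀ x y d z : ℤ, -12 ≤ x ∧ x ≤ 12 → -12 ≤ y ∧ y ≤ 12 → y - x + 32 * d = 32 * z →
      x = y ∧ d = z := by omega
  have d1 := digit _ _ ((h 1 0 - g 1 0) + 32 * ((h 2 0 - g 2 0) + 32 * ((h 0 1 - g 0 1) +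
    32 * ((h 1 1 - g 1 1) + 32 * ((h 2 1 - g 2 1) + 32 * ((h 0 2 - g 0 2) +
    32 * ((h 1 2 - g 1 2) + 32 * (h 2 2 - g 2 2)))))))) (32 ^ 8 * c) (hg 0 0) (hh 0 0) (by
      simp only [matrixCode, keyModulus] at hc
      push_cast at hc
      linear_combination hc)
  have d2 := digit _ _ _ (32 ^ 7 * c) (hg 1 0) (hh 1 0) (d1.2.trans (by ring))
  have d3 := digit _ _ _ (32 ^ 6 * c) (hg 2 0) (hh 2 0) (d2.2.trans (by ring))
  have d4 := digit _ _ _ (32 ^ 5 * c) (hg 0 1) (hh 0 1) (d3.2.trans (by ring))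
  have d5 := digit _ _ _ (32 ^ 4 * c) (hg 1 1) (hh 1 1) (d4.2.trans (by ring))
  have d6 := digit _ _ _ (32 ^ 3 * c) (hg 2 1) (hh 2 1) (d5.2.trans (by ring))
  have d7 := digit _ _ _ (32 ^ 2 * c) (hg 0 2) (hh 0 2) (d6.2.trans (by ring))
  have d8 := digit _ _ _ (32 * c) (hg 1 2) (hh 1 2) (d7.2.trans (by ring))
  have d9 := digit _ _ 0 c (hg 2 2) (hh 2 2) (by rw [mul_zero, add_zero]; exact d8.2)
  ext i j
  fin_cases i <;> fin_cases j
  exacts [d1.1, d4.1, d7.1, d2.1, d5.1, d8.1, d3.1, d6.1, d9.1]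

/-- The left factor of a key. -/
def leftKey (g : Matrix (Fin 3) (Fin 3) ℤ) (k : Fin 3) : ℕ :=
  toKey (keyFactor * (cofactors g 0 k + 32 * cofactors g 1 k + 32 ^ 2 * cofactors g 2 k))

/-- The right factor of a key. -/
def rightKey (s : Equiv.Perm (Fin 3)) (g : Matrix (Fin 3) (Fin 3) ℤ) (k : Fin 3) : ℕ :=
  toKey (g (s⁻¹ k) (s⁻¹ 0) + 32 ^ 3 * g (s⁻¹ k) (s⁻¹ 1) + 32 ^ 6 * g (s⁻¹ k) (s⁻¹ 2))

/-- The key of `g⁻¹ s(h)`. -/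
def key (g : Matrix (Fin 3) (Fin 3) ℤ) (s : Equiv.Perm (Fin 3)) (h : Matrix (Fin 3) (Fin 3) ℤ) : ℕ :=
  (leftKey g 0 * rightKey s h 0 + leftKey g 1 * rightKey s h 1 + leftKey g 2 * rightKey s h 2) %
    keyModulus

theorem key_modEq {g h : Matrix (Fin 3) (Fin 3) ℤ} (hg : IsSmall g) (hh : IsSmall h)
    (s : Equiv.Perm (Fin 3)) :
    ((key g s h : ℕ) : ℤ) ≡
      keyFactor * matrixCode ((toSL g)⁻¹ * permConj s (toSL h)).1 [ZMOD keyModulus] := by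
  have hm : ((toSL g)⁻¹ * permConj s (toSL h)).1 = cofactors g * h.submatrix ⇑s⁻¹ ⇑s⁻¹ := by
    rw [← hg.coe_inv_toSL]
    conv_rhs => rw [← hh.coe_toSL]
    rfl
  rw [hm, key, Int.natCast_mod]
  refine (Int.mod_modEq _ _).trans ?_
  push_cast
  refine ((((toKey_modEq _).mul (toKey_modEq _)).add ((toKey_modEq _).mul (toKey_modEq _))).add
    ((toKey_modEq _).mul (toKey_modEq _))).trans ?_
  rw [matrixCode]
  simp only [Matrix.mul_apply, Fin.sum_univ_three, Matrix.submatrix_apply]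
  exact congrArg (· % (keyModulus : ℤ)) (by ring)

theorem bounded_of_isSmall {g h : Matrix (Fin 3) (Fin 3) ℤ} (hg : IsSmall g) (hh : IsSmall h)
    (s : Equiv.Perm (Fin 3)) (i j : Fin 3) :
    -12 ≤ ((toSL g)⁻¹ * permConj s (toSL h)).1 i j ∧
      ((toSL g)⁻¹ * permConj s (toSL h)).1 i j ≤ 12 := by
  have hm : ((toSL g)⁻¹ * permConj s (toSL h)).1 = cofactors g * h.submatrix ⇑s⁻¹ ⇑s⁻¹ := by
    rw [← hg.coe_inv_toSL]
    conv_rhs => rw [← hh.coe_toSL]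
    rfl
  have hb : ∀ x y : ℤ, -2 ≤ x → x ≤ 2 → -2 ≤ y → y ≤ 2 → -4 ≤ x * y ∧ x * y ≤ 4 := by
    intro x y h1 h2 h3 h4
    constructor <;> nlinarith
  have hk : ∀ k, -4 ≤ cofactors g i k * h (s⁻¹ k) (s⁻¹ j) ∧
      cofactors g i k * h (s⁻¹ k) (s⁻¹ j) ≤ 4 := fun k =>
    hb _ _ (hg.2 i k).2.2.1 (hg.2 i k).2.2.2 (hh.2 _ _).1 (hh.2 _ _).2.1
  rw [hm, Matrix.mul_apply, Fin.sum_univ_three]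
  simp only [Matrix.submatrix_apply]
  have := hk 0
  have := hk 1
  have := hk 2
  constructor <;> linarith

/-- The unitary matrix of the element with a given key. -/
noncomputable def keyUnit (s : Equiv.Perm (Fin 3)) (k : ℕ) :
    Matrix (Equiv.Perm (Fin 3)) (Equiv.Perm (Fin 3))
      (MonoidAlgebra ℝ (Matrix.SpecialLinearGroup (Fin 3) ℤ)) :=
  open Classical in
  if h : ∃ g : Matrix.SpecialLinearGroup (Fin 3) ℤ, (∀ i j, -12 ≤ g.1 i j ∧ g.1 i j ≤ 12) ∧
      (k : ℤ) ≡ keyFactor * matrixCode g.1 [ZMOD keyModulus]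
    then crossedUnit permConj ⟨h.choose, s⟩ else crossedUnit permConj 1

theorem conjTranspose_keyUnit_mul_self (s : Equiv.Perm (Fin 3)) (k : ℕ) :
    (keyUnit s k)ᴴ * keyUnit s k = 1 := by
  unfold keyUnit
  split_ifs <;> exact conjTranspose_crossedUnit_mul_self _ _

theorem keyUnit_key {g h : Matrix (Fin 3) (Fin 3) ℤ} (hg : IsSmall g) (hh : IsSmall h)
    (s : Equiv.Perm (Fin 3)) :
    keyUnit s (key g s h) = crossedUnit permConj (sandwich permConj (toSL g) s (toSL h)) := by
  have hex : ∃ x : Matrix.SpecialLinearGroup (Fin 3) ℤ,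
      (∀ i j, -12 ≤ x.1 i j ∧ x.1 i j ≤ 12) ∧
      ((key g s h : ℕ) : ℤ) ≡ keyFactor * matrixCode x.1 [ZMOD keyModulus] :=
    ⟨_, bounded_of_isSmall hg hh s, key_modEq hg hh s⟩
  rw [keyUnit, dif_pos hex, sandwich_eq]
  congr 2
  exact Subtype.ext (eq_of_matrixCode hex.choose_spec.1 (bounded_of_isSmall hg hh s)
    hex.choose_spec.2 (key_modEq hg hh s))

end Key

/-! ## Gram vectors -/

/-- An element of the half basis, and its coordinate vectors in the trivial, the sign and the
two-dimensional representation of the symmetric group. The entries of the vectors are stored in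
blocks of 18 bits. The vectors `std₀` and `std₁` are the first two of three vectors of sum zero. -/
structure GramVector where
  mat : Matrix (Fin 3) (Fin 3) ℤ
  triv : ℕ
  sign : ℕ
  std₀ : ℕ
  std₁ : ℕ

namespace GramVector

/-- An entry of a stored vector, with offset `2 ^ 17`. -/
def entry (d r : ℕ) : ℕ :=
  Nat.mod (Nat.add (Nat.div d (Nat.pow 2 (Nat.mul 18 r))) 131072) 262144

/-- The entries of a stored vector of length `n`, with offset `2 ^ 17`. -/
noncomputable def entries (d n : ℕ) : List ℕ := Nat.rec [] (fun r ih => entry d r :: ih) n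

theorem entries_succ (d n : ℕ) : entries d (n + 1) = entry d n :: entries d n := rfl

theorem length_entries (d n : ℕ) : (entries d n).length = n := by
  induction n with
  | zero => rfl
  | succ n ih => exact congrArg (· + 1) ih

theorem lt_of_mem_entries {d n a : ℕ} (h : a ∈ entries d n) : a < 262144 := by
  induction n with
  | zero => exact absurd h (List.not_mem_nil)
  | succ n ih =>
    rw [entries_succ, List.mem_cons] at h
    rcases h with h | h
    · exact h ▸ Nat.mod_lt _ (by norm_num)
    · exact ih h

/-- The third of three vectors of sum zero. -/
def balance (l m : List ℕ) : List ℕ := List.zipWith (fun a b => 393216 - (a + b)) l m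

/-- The negative of a vector. -/
def opposite (l : List ℕ) : List ℕ := l.map fun a => 262144 - a

/-- The three vectors which the symmetric group permutes. -/
noncomputable def std (v : GramVector) : Fin 3 → List ℕ :=
  ![entries v.std₀ 63, entries v.std₁ 63, balance (entries v.std₀ 63) (entries v.std₁ 63)]

/-- The odd permutations are the reflections of a triangle. -/
def isOdd (s : Equiv.Perm (Fin 3)) : Bool := decide (s 1 ≠ s 0 + 1)

/-- All entries of a Gram vector. -/
noncomputable def leftEntries (v : GramVector) : List ℕ :=
  entries v.triv 31 ++ (entries v.sign 32 ++ (v.std 0 ++ (v.std 1 ++ v.std 2)))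

/-- All entries of the image of a Gram vector under a permutation. -/
noncomputable def rightEntries (s : Equiv.Perm (Fin 3)) (v : GramVector) : List ℕ :=
  entries v.triv 31 ++
    ((bif isOdd s then opposite (entries v.sign 32) else entries v.sign 32) ++
      (v.std (s⁻¹ 0) ++ (v.std (s⁻¹ 1) ++ v.std (s⁻¹ 2))))

theorem length_std (v : GramVector) (m : Fin 3) : (v.std m).length = 63 := by
  fin_cases m <;> simp [std, length_entries, balance]

theorem length_leftEntries (v : GramVector) : v.leftEntries.length = 252 := by
  simp [leftEntries, length_entries, length_std]

theorem length_rightEntries (s : Equiv.Perm (Fin 3)) (v : GramVector) :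
    (v.rightEntries s).length = 252 := by
  cases h : isOdd s <;> simp [rightEntries, length_entries, length_std, h, opposite]

theorem le_of_mem_entries {d n a : ℕ} (h : a ∈ entries d n) : a ≤ 393216 :=
  (lt_of_mem_entries h).le.trans (by norm_num)

theorem le_of_mem_balance {l m : List ℕ} {a : ℕ} (h : a ∈ balance l m) : a ≤ 393216 := by
  rw [balance] at h
  induction l generalizing m with
  | nil => simp at h
  | cons b l ih =>
    cases m with
    | nil => simp at h
    | cons c m =>
      rcases List.mem_cons.1 h with rfl | h
      · exact Nat.sub_le _ _
      · exact ih h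

theorem le_of_mem_std {v : GramVector} {m : Fin 3} {a : ℕ} (h : a ∈ v.std m) : a ≤ 393216 := by
  fin_cases m
  · exact le_of_mem_entries (show a ∈ entries v.std₀ 63 from h)
  · exact le_of_mem_entries (show a ∈ entries v.std₁ 63 from h)
  · exact le_of_mem_balance (show a ∈ balance (entries v.std₀ 63) (entries v.std₁ 63) from h)

theorem le_of_mem_leftEntries {v : GramVector} {a : ℕ} (h : a ∈ v.leftEntries) : a ≤ 393216 := by
  simp only [leftEntries, List.mem_append] at h
  rcases h with h | h | h | h | h
  exacts [le_of_mem_entries h, le_of_mem_entries h, le_of_mem_std h, le_of_mem_std h,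
    le_of_mem_std h]

theorem le_of_mem_rightEntries {s : Equiv.Perm (Fin 3)} {v : GramVector} {a : ℕ}
    (h : a ∈ v.rightEntries s) : a ≤ 393216 := by
  simp only [rightEntries, List.mem_append] at h
  rcases h with h | h | h | h | h
  · exact le_of_mem_entries h
  · cases hs : isOdd s <;> rw [hs] at h
    · exact le_of_mem_entries (show a ∈ entries v.sign 32 from h)
    · obtain ⟨b, -, rfl⟩ := List.mem_map.1 h
      exact (Nat.sub_le _ _).trans (by norm_num)
  exacts [le_of_mem_std h, le_of_mem_std h, le_of_mem_std h]

/-- The vector in the trivial representation. -/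
noncomputable def trivVec (v : GramVector) : List ℤ := shiftList 131072 (entries v.triv 31)

/-- The vector in the sign representation. -/
noncomputable def signVec (v : GramVector) : List ℤ := shiftList 131072 (entries v.sign 32)

/-- The vectors in the permutation representation. -/
noncomputable def stdVec (v : GramVector) (m : Fin 3) : List ℤ := shiftList 131072 (v.std m)

/-- The scalar product of a Gram vector and the image of another one under a permutation. -/
noncomputable def pairing (v : GramVector) (s : Equiv.Perm (Fin 3)) (w : GramVector) : ℤ :=
  listDot (shiftList 131072 v.leftEntries) (shiftList 131072 (w.rightEntries s))

theorem shiftList_opposite (d n : ℕ) :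
    shiftList 131072 (opposite (entries d n)) = (shiftList 131072 (entries d n)).map (- ·) := by
  rw [shiftList, shiftList, opposite, List.map_map, List.map_map]
  refine List.map_congr_left fun a ha => ?_
  have := lt_of_mem_entries ha
  simp only [Function.comp_apply]
  omega

theorem pairing_eq (v : GramVector) (s : Equiv.Perm (Fin 3)) (w : GramVector) :
    v.pairing s w = listDot v.trivVec w.trivVec +
      (bif isOdd s then -listDot v.signVec w.signVec else listDot v.signVec w.signVec) +
      ∑ m, listDot (v.stdVec m) (w.stdVec (s⁻¹ m)) := by
  have happ : ∀ l m : List ℕ,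
      shiftList 131072 (l ++ m) = shiftList 131072 l ++ shiftList 131072 m :=
    fun l m => List.map_append
  have hlen : ∀ l : List ℕ, (shiftList 131072 l).length = l.length := fun l => List.length_map _
  rw [pairing, leftEntries, rightEntries]
  simp only [happ]
  rw [listDot_append _ _ _ _ (by simp only [hlen, length_entries]),
    listDot_append _ _ _ _ (by cases isOdd s <;> simp [hlen, length_entries, opposite]),
    listDot_append _ _ _ _ (by simp only [hlen, length_std]),
    listDot_append _ _ _ _ (by simp only [hlen, length_std]), Fin.sum_univ_three]
  have h : listDot (shiftList 131072 (entries v.sign 32)) (shiftList 131072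
      (bif isOdd s then opposite (entries w.sign 32) else entries w.sign 32)) =
      bif isOdd s then -listDot v.signVec w.signVec else listDot v.signVec w.signVec := by
    cases isOdd s
    · rfl
    · rw [cond_true, cond_true, shiftList_opposite, listDot_neg]
      rfl
  rw [h]
  simp only [trivVec, stdVec]
  ring

/-- The matrices of a Gram vector give a sum of hermitian squares. -/
theorem isSumOfHermitianSquares_pairing (l : List GramVector) :
    IsSumOfHermitianSquares (∑ s, (l.map fun v => (l.map fun w =>
      (v.pairing s w : ℝ) •
        crossedUnit permConj (sandwich permConj (toSL v.mat) s (toSL w.mat))).sum).sum) := by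
  have hlen : ∀ l : List ℕ, (shiftList 131072 l).length = l.length := fun l => List.length_map _
  have h1 := isSumOfHermitianSquares_gram permConj (fun v : GramVector => toSL v.mat)
    (fun _ v => v.trivVec) 31 (fun _ v => by simp only [trivVec, hlen, length_entries]) l
  have h2 := isSumOfHermitianSquares_gram permConj (fun v : GramVector => toSL v.mat)
    (fun σ v => bif isOdd σ then v.signVec.map (- ·) else v.signVec) 32
    (fun σ v => by cases isOdd σ <;> simp [signVec, hlen, length_entries]) l
  have h3 := isSumOfHermitianSquares_gram permConj (fun v : GramVector => toSL v.mat)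
    (fun σ v => v.stdVec (σ⁻¹ 2)) 63 (fun _ v => by simp only [stdVec, hlen, length_std]) l
  have e2 : ∀ (s : Equiv.Perm (Fin 3)) (v w : GramVector),
      ∑ σ, listDot (bif isOdd σ then v.signVec.map (- ·) else v.signVec)
        (bif isOdd (σ * s) then w.signVec.map (- ·) else w.signVec) =
      6 * (bif isOdd s then -listDot v.signVec w.signVec else listDot v.signVec w.signVec) := by
    intro s v w
    have hodd : ∀ σ s : Equiv.Perm (Fin 3), isOdd (σ * s) = xor (isOdd σ) (isOdd s) := by decide
    rw [Finset.sum_congr rfl fun σ _ => (?_ : _ =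
      (bif isOdd s then -listDot v.signVec w.signVec else listDot v.signVec w.signVec))]
    · rw [Finset.sum_const, Finset.card_univ, Fintype.card_perm, Fintype.card_fin, nsmul_eq_mul]
      rfl
    · have hneg : listDot (v.signVec.map (- ·)) w.signVec = -listDot v.signVec w.signVec := by
        rw [← listDot_neg_neg, ← listDot_neg, List.map_map]
        simp
      rw [hodd]
      cases isOdd σ <;> cases isOdd s <;> simp [listDot_neg, hneg]
  have e3 : ∀ (s : Equiv.Perm (Fin 3)) (v w : GramVector),
      ∑ σ : Equiv.Perm (Fin 3), listDot (v.stdVec (σ⁻¹ 2)) (w.stdVec ((σ * s)⁻¹ 2)) =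
      2 * ∑ m, listDot (v.stdVec m) (w.stdVec (s⁻¹ m)) := by
    intro s v w
    have hcard : ∀ m : Fin 3,
        (Finset.univ.filter fun σ : Equiv.Perm (Fin 3) => σ⁻¹ 2 = m).card = 2 := by decide
    simp only [mul_inv_rev, Equiv.Perm.mul_apply]
    rw [← Finset.sum_fiberwise Finset.univ (fun σ : Equiv.Perm (Fin 3) => σ⁻¹ 2), Finset.mul_sum]
    refine Finset.sum_congr rfl fun m _ => ?_
    rw [Finset.sum_congr rfl fun σ hσ => (?_ : _ = listDot (v.stdVec m) (w.stdVec (s⁻¹ m))),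
      Finset.sum_const, hcard, nsmul_eq_mul]
    · rfl
    · rw [(Finset.mem_filter.1 hσ).2]
  simp only [e2, e3, Finset.sum_const, Finset.card_univ, Fintype.card_perm, Fintype.card_fin,
    nsmul_eq_mul] at h1 h2 h3
  have h := ((h1.smul (c := 1 / 6) (by norm_num)).add (h2.smul (c := 1 / 6) (by norm_num))).add
    (h3.smul (c := 1 / 2) (by norm_num))
  convert h using 1
  simp only [Finset.smul_sum, ← Finset.sum_add_distrib, List.smul_sum, List.map_map,
    ← List.sum_map_add]
  refine Finset.sum_congr rfl fun s _ => ?_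
  congr 1
  refine List.map_congr_left fun v _ => ?_
  simp only [Function.comp_apply, List.smul_sum, List.map_map, ← List.sum_map_add]
  congr 1
  refine List.map_congr_left fun w _ => ?_
  simp only [smul_smul, ← add_smul, pairing_eq]
  congr 1
  have : (Nat.factorial 3 : ℤ) = 6 := rfl
  rw [this]
  push_cast
  ring

end GramVector

/-! ## Collecting the terms of a Gram matrix -/

/-- A Gram vector in packed form, with the factors of its keys. -/
structure PackedVector where
  k₀ : ℕ
  k₁ : ℕ
  k₂ : ℕ
  packed : ℕ
  weight : ℕ

namespace PackedVector

/-- The packed form of a Gram vector. -/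
noncomputable def left (v : GramVector) : PackedVector :=
  ⟨leftKey v.mat 0, leftKey v.mat 1, leftKey v.mat 2, packLow (2 ^ 48) v.leftEntries,
    131072 * v.leftEntries.sum⟩

/-- The packed form of the image of a Gram vector under a permutation. -/
noncomputable def right (s : Equiv.Perm (Fin 3)) (v : GramVector) : PackedVector :=
  ⟨rightKey s v.mat 0, rightKey s v.mat 1, rightKey s v.mat 2,
    packHigh (2 ^ 48) (v.rightEntries s), 131072 * (v.rightEntries s).sum⟩

/-- Evaluate all components before going on with `c`. -/
noncomputable def force (x : PackedVector) (c : PackedVector → Bool) : Bool :=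
  _root_.force x.k₀ fun k₀ => _root_.force x.k₁ fun k₁ => _root_.force x.k₂ fun k₂ =>
    _root_.force x.packed fun p => _root_.force x.weight fun w => c ⟨k₀, k₁, k₂, p, w⟩

theorem force_eq (x : PackedVector) (c : PackedVector → Bool) : x.force c = c x := by
  simp only [force, _root_.force_eq]

/-- The key of a product. -/
def pairKey (x y : PackedVector) : ℕ :=
  (x.k₀ * y.k₀ + x.k₁ * y.k₁ + x.k₂ * y.k₂) % keyModulus

/-- The negative of the scalar product. -/
def pairValue (x y : PackedVector) : ℤ :=
  Int.subNatNat (x.weight + y.weight)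
    (x.packed * y.packed / (2 ^ 48) ^ 251 % 2 ^ 48 + 252 * 131072 ^ 2)

theorem pairValue_left_right (v : GramVector) (s : Equiv.Perm (Fin 3)) (w : GramVector) :
    pairValue (left v) (right s w) = -v.pairing s w := by
  have h1 : (left v).packed * (right s w).packed / (2 ^ 48) ^ 251 % 2 ^ 48 =
      natDot v.leftEntries (w.rightEntries s) := by
    have hl : (left v).packed = packLow (2 ^ 48) v.leftEntries := by rw [left]
    have hr : (right s w).packed = packHigh (2 ^ 48) (w.rightEntries s) := by rw [right]
    rw [hl, hr]
    generalize hX : 2 ^ 48 = X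
    exact packLow_mul_packHigh_div_mod _ _
      v.length_leftEntries (w.length_rightEntries s) (fun _ => GramVector.le_of_mem_leftEntries)
      (fun _ => GramVector.le_of_mem_rightEntries) (by rw [← hX]; norm_num)
  rw [pairValue, h1, Int.subNatNat_eq_coe, GramVector.pairing,
    listDot_shiftList _ _ _ (v.length_leftEntries.trans (w.length_rightEntries s).symm),
    v.length_leftEntries, left, right]
  push_cast
  ring

/-- Subtract a row of a Gram matrix. -/
noncomputable def addRow (x : PackedVector) (l : List PackedVector) :
    TermTree → (TermTree → Bool) → Bool :=
  List.rec (motive := fun _ => TermTree → (TermTree → Bool) → Bool) (fun t c => c t)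
    (fun y _ ih t c => _root_.force (pairKey x y) fun k =>
      t.insert k (pairValue x y) fun t' => ih t' c) l

/-- Subtract a Gram matrix. -/
noncomputable def addRows (l : List PackedVector) (m : List GramVector) :
    TermTree → (TermTree → Bool) → Bool :=
  List.rec (motive := fun _ => TermTree → (TermTree → Bool) → Bool) (fun t c => c t)
    (fun v _ ih t c => (left v).force fun x => addRow x l t fun t' => ih t' c) m

/-- Evaluate the packed forms of a list of Gram vectors. -/
noncomputable def forceRight (s : Equiv.Perm (Fin 3)) (l : List GramVector) :
    (List PackedVector → Bool) → Bool :=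
  List.rec (motive := fun _ => (List PackedVector → Bool) → Bool) (fun c => c [])
    (fun v _ ih c => (right s v).force fun x => ih fun m => c (x :: m)) l

theorem forceRight_eq (s : Equiv.Perm (Fin 3)) (l : List GramVector)
    (c : List PackedVector → Bool) : forceRight s l c = c (l.map (right s)) := by
  induction l generalizing c with
  | nil => rfl
  | cons v l ih =>
    change (right s v).force (fun x => forceRight s l fun m => c (x :: m)) = _
    rw [force_eq, ih]
    rfl

variable {M : Type*} [AddCommGroup M] [Module ℝ M] (U : ℕ → M)

theorem exists_of_addRow (x : PackedVector) (l : List PackedVector) (t : TermTree)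
    (c : TermTree → Bool) (h : addRow x l t c = true) :
    ∃ t', c t' = true ∧ t'.eval U =
      t.eval U + (l.map fun y => (pairValue x y : ℝ) • U (pairKey x y)).sum := by
  induction l generalizing t with
  | nil => exact ⟨t, h, by simp⟩
  | cons y l ih =>
    change _root_.force (pairKey x y) (fun k =>
      t.insert k (pairValue x y) fun t' => addRow x l t' c) = true at h
    rw [_root_.force_eq] at h
    obtain ⟨t₁, h1, h2⟩ := TermTree.exists_of_insert U _ _ _ _ h
    obtain ⟨t₂, h3, h4⟩ := ih _ h1
    exact ⟨t₂, h3, by rw [h4, h2, List.map_cons, List.sum_cons, add_assoc]⟩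

theorem exists_of_addRows (l : List PackedVector) (m : List GramVector) (t : TermTree)
    (c : TermTree → Bool) (h : addRows l m t c = true) :
    ∃ t', c t' = true ∧ t'.eval U = t.eval U + (m.map fun v =>
      (l.map fun y => (pairValue (left v) y : ℝ) • U (pairKey (left v) y)).sum).sum := by
  induction m generalizing t with
  | nil => exact ⟨t, h, by simp⟩
  | cons v m ih =>
    change (left v).force (fun x => addRow x l t fun t' => addRows l m t' c) = true at h
    rw [force_eq] at h
    obtain ⟨t₁, h1, h2⟩ := exists_of_addRow U _ _ _ _ h
    obtain ⟨t₂, h3, h4⟩ := ih _ h1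
    exact ⟨t₂, h3, by rw [h4, h2, List.map_cons, List.sum_cons, add_assoc]⟩

/-- Add a list of terms. -/
noncomputable def addTerms (l : List (ℕ × ℤ)) : TermTree → (TermTree → Bool) → Bool :=
  List.rec (motive := fun _ => TermTree → (TermTree → Bool) → Bool) (fun t c => c t)
    (fun p _ ih t c => _root_.force p.1 fun k => t.insert k p.2 fun t' => ih t' c) l

theorem exists_of_addTerms (l : List (ℕ × ℤ)) (t : TermTree)
    (c : TermTree → Bool) (h : addTerms l t c = true) :
    ∃ t', c t' = true ∧ t'.eval U = t.eval U + (l.map fun p => (p.2 : ℝ) • U p.1).sum := by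
  induction l generalizing t with
  | nil => exact ⟨t, h, by simp⟩
  | cons p l ih =>
    change _root_.force p.1 (fun k => t.insert k p.2 fun t' => addTerms l t' c) = true at h
    rw [_root_.force_eq] at h
    obtain ⟨t₁, h1, h2⟩ := TermTree.exists_of_insert U _ _ _ _ h
    obtain ⟨t₂, h3, h4⟩ := ih _ h1
    exact ⟨t₂, h3, by rw [h4, h2, List.map_cons, List.sum_cons, add_assoc]⟩

/-- The difference of the terms `l` and of a Gram matrix has norm at most `b`. -/
noncomputable def isApproximation (s : Equiv.Perm (Fin 3)) (m : List GramVector)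
    (l : List (ℕ × ℤ)) (b : ℕ) : Bool :=
  forceRight s m fun r => addTerms l .leaf fun t => addRows r m t fun t' => Nat.ble t'.norm b

theorem exists_of_isApproximation {s : Equiv.Perm (Fin 3)} {m : List GramVector}
    {l : List (ℕ × ℤ)} {b : ℕ} (hm : ∀ v ∈ m, IsSmall v.mat)
    (h : isApproximation s m l b = true) :
    ∃ t : TermTree, t.norm ≤ b ∧ t.eval (keyUnit s) =
      (l.map fun p => (p.2 : ℝ) • keyUnit s p.1).sum -
        (m.map fun v => (m.map fun w => (v.pairing s w : ℝ) • crossedUnit permConj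
          (sandwich permConj (toSL v.mat) s (toSL w.mat))).sum).sum := by
  rw [isApproximation, forceRight_eq] at h
  obtain ⟨t₁, h1, h2⟩ := exists_of_addTerms (keyUnit s) _ _ _ h
  obtain ⟨t₂, h3, h4⟩ := exists_of_addRows (keyUnit s) _ _ _ _ h1
  refine ⟨t₂, Nat.le_of_ble_eq_true h3, ?_⟩
  rw [h4, h2, TermTree.eval, zero_add, sub_eq_add_neg, List.neg_sum_map]
  congr 2
  refine List.map_congr_left fun v hv => ?_
  rw [List.neg_sum_map, List.map_map]
  congr 1
  refine List.map_congr_left fun w hw => ?_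
  rw [Function.comp_apply, pairValue_left_right, Int.cast_neg, neg_smul]
  congr 2
  exact keyUnit_key (hm v hv) (hm w hw) s

end PackedVector

/-! ## The approximate Gram matrix -/

/-- The half basis and the vectors of an approximate Gram matrix of the Laplacian. -/
def gramVectors : List GramVector := [
  ⟨!![1, -2, 0; 0, 1, 0; 0, 0, 1],
    0x3f6a700017eee700783f86ff90c3eb9f04b0fe0cc00167e6d307f23f382039efe6a104abfeffdfb933d47c066b3fda00104c02bbfb550046df6e3fc610f7cac1081fc5ac23f6,
    0x27a1be3c7f6ec0004bf789fb9f50a52437510577fe1fd0d10fddb7fc3f3e5c1065bbe5a7,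
    0x16c3c092905a8805ab0095bfd25f93b8051bfca8be722f7917f10700c7004dffb7f7c6abfab6bf21cfb3dc1dabfdfc4067b002ebd95cf011bdbecf70643d77040cc0cab081c3fbd0fd7ebed5cf471c078208584113b053dbd7c6ff39bd2aafee7c2477ff993fd55029bffa3d,
    0x57fbfb3a3eec9fad9bf4d0fb863fa3508563ed8b033101377f75c3fc3afe68c066bfffe7f4ddff50ffe51ffa9801fefc3cbf9eb0574c12b1fdd980dd503fa7e0370037ff7c904d400c260674c4eb5ff53bbf16fb833e000f926402a7fe1181b3d0220be2eaff973e782f820c1eda⟩,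
  ⟨!![1, -1, -1; 0, 1, 0; 0, 0, 1],
    0xb97fdc1bfe9ff7af3ee48fcb3ff871faa33f010fcddc204e01ccbd7d80dbf830d50e4640b97f96e41e1a08b47a1a6fd0504507ddf87f9b5f7b50094cf9617c5f6f8dd8022c,
    0x16dc706443ca07,
    0x3fcadfe5a815f30447bff0bfe4d3f35e002000d390215bf76e00cc7e197fd107f33af36d8149d01513fb75f1b4c215dfe8a41624fc19bf26a00157e9aceffc3eb7e0006be9f5030d3f659f7a68414300993f0e8022f79a66f4ccbe6c7020d7f9b60ac580c86fe2d3c76e0bda3e408086541084fbaec0ee2003e824e1fc4fc03d6062880f89f66d3b37e00f97ebe3,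
    0x1a442f218c2389⟩,
  ⟨!![1, -1, -1; 0, 1, 0; 0, 1, 1],
    0x3f9aafdd20012afa728176a03f2c02fdf953c08790797bfe680062bf55f0bc9c08effc7bc1cde06e74224ffaad42d6eebb8fcc9c02bffe54ff459bffd3fb193e4adf595c0940,
    0x1303be1e1fa203d70dffb4bf1a2fa31c24c2fc05fed520142441fef5787e4fe0e377fc6eeeb340e5f0229bebf6fc0180b48f80c7f5c70064403a8,
    0x27e00dcbf2cd0258befd506db7f5e1f8f540e2cfb93c0132fa9e409d4fad9c11a50a943ff61fab04173e013c8107ffa62005e3f65c00691fdd6fc3ea00b03ea8f0660bf3f3fc6a82069fa7e0079d0923010e1f675c21e304a8017e5fe70ff62b00050042f029ec0082021c4138b0a9502a16ecbcfdeaafe9440976fa273f6ca0663bf933fa6a4075204af40ef0,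
    0x3fcce01bd4072406d8fffb7002f3f03b06173f88bfddbffd8405843dddf043ffdd47fcc7c134b079f3ca65f6d87d7d4006f00763022fbfbe010e880af9f90ebd84bfda43f1a20679000c3043fbf9e6fbb8805acfb52c0611fa277adf5030d4080dfd8e7ee61fb29ffa7801353ee20fd617c1f8079301fe6fce0005c70111c0384fc7a0080b03d93efecfa8f00211⟩,
  ⟨!![1, -1, -1; 0, 1, 1; 0, 0, 1],
    0x173ebfc1501857f1d0f652bde62efc3805dcfda4c0cd1f8db3e001e81e00b570e1c3f927f75f410e90b273ed260005416a5007400808,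
    0xf60ff07904b6ffe7df44400f56f9d73fcbd086240461f684fd6ce05c1c0c1cfd1dbba34f1937f826f17900a41f9a8013240182c113afb6e7c875f254bf522,
    0x15cdbfecafde83ea39067b40581fc14bd59902687eefa05003f0af02eb01c6f02c9806dafeb7bfa51fd997c6dc01fec127d04277f1f20acffff0d007cbf62d02d17998cfd74fd200f1f77f654f1c601cc5fc753e281041d7e78700d3be041068fbfd93f7f741b1109067f4c4fea83fb65,
    0x8200ee4062cfc4240777fdf540482044080218f736fff4dff1affa46f5fec10fd05e0422c003eebd96e06513e29cf722be9beff5000360f35f7fc9ff612ffaf3f993fe0a201548277dfc3e3fd86feed416adf06dc1f9909823fb44fcb883d10fa36bfc5308ed022b4088cbe828016bfe8ef00c30070ff8ba018b9faefbfb8c00e23da8ef86e7b95a006e0081d⟩,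
  ⟨!![1, -1, 0; 0, 1, -1; 0, 0, 1],
    0x842ff9b6be46b0226be5dd11818067d04cffe43af559beacce5f27e3a8f2fcc1361034340a3cf94700ca7,
    0x759ffac7c1232f56183178f99501510f21c02bdf055641115fe758481f0161bee22fc78fc1cbfe623bb84fac680708,
    0x100c5f62fbf9b5098800b5502197ede3fd94bfbef03f6be6e3fd3700f04f0eec21ff001bc0264,
    0xb4850157021780064415a4fcfe41b0614d4408890b70424cff983b9453045e3c304f2463e9d2f2d8027b508618233f000341916fde5fdc4d0051fd7dbf3a4c122a⟩,
  ⟨!![1, -1, 0; 0, 1, 0; -1, 0, 1],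
    0x4a205a942543ffbb3ee2105987e3c6fb2e7de82f5cc00baaf44c40d27fedf416f00285408ea04b740346fd64018cc04733e5fdee9efc37f0091ff7eef67d813e20757c06b1,
    0x1bd3f29cfc80c0be40139000c3012fc12e603a1be8cdff303f0750932bf2520561ff614023f823d0042bc0ef500b4bf6d5fd9bff798f2eb80dac00127dbccfed7fd9e2fb42801de,
    0x4469ff84009a5ff8b806d3018080473fd9400f74fd0640f74ff1c0140ef81000ded02823fceb01123deb40158bfae0f9a0bed88ff5e7f4a8084400ac3feba035b2fa3b4071dfd3101aff0165c1926fbb2412d500087eaf8fcd77e0defe1cffef00536bd83806cfffa28028cfed4afc26bde6afe72006de,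
    0x38f4fd4c7fd92fa1c3f29ffeb83f3cb0283c09da08163ec00029d8000001947e776fff27ec2afcdbfef18fa78c0a62f7db844edfd9ac0bfafd05c17f3fc15c0b4ef572c0830ff94c0af0ff2940cd6ff2681125fc69be6720564bcc70fd6d7fd1afe8e80aa700b100d28f9104237ffe348058d0155003a9032ec3f76026d40396⟩,
  ⟨!![1, -1, 0; 0, 1, 0; -1, 1, 1],
    0x1c2c41f0600af3f3c7ff19feab600373cb5cfaffffaa6012b3e659f5168538c1a8b02c1afb5ebc4e8ff08bd6a802177fd1f,
    0x9095f61e7c630fb9dbbb6104f87da97ffebbe50804d53fdd00a6241c790384831d9fdc13d26f,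
    0x1e7cff780033a813ac0a1a7f711fd410111f0090c247403d23fd24e63f0182af5767be1406eebcad702873dc1afa53bfe960bf5ff0c7fe2c44657fbf5c4fd5f7da8129affcbbebd3f6483efa0fa06bff0ef2f74463c11693f132,
    0x2d7c3ddeefc7a3e8deff1781550f8b57f40d01b8412e9fe394564604ecfe533fd627af2a074e7e5cdff62c0975fcc082735fc8e81b9cf8c33bf30efd940841⟩,
  ⟨!![1, -1, 0; 0, 1, 0; 0, -1, 1],
    0xf093027d01019fc70c0fce03da3df2cff92c45f3,
    0x3fedba6eef53944553f469375fafd5636c69,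
    0x13f3dfe563e6abff1082bf2dc8bfbeebffd47e379,
    0x10a340249bf27cfb9bfe3af00d2b8427f8e8be291fceb7d4d2fb1cbfd520bf40039e⟩,
  ⟨!![1, -1, 0; 0, 1, 0; 0, 0, 1],
    0x6acdbd22f,
    0x1c4e8,
    0x68d67fbfad36879884,
    0x74ab44362⟩,
  ⟨!![1, -1, 0; 0, 1, 0; 0, 1, 1],
    0x46077f3c713a646433e57fbd731,
    0x33943c676fe0f7ca2afe8f7bde405bf7d87a0ef47b6c1,
    0x2f40c0af40607c0c58fc193d4c3f676fe429feaefcf98fe42c073fe61af61d1fa2f8018ef871bfb95ff9a81afbe975c44740308c02ae0643c3028,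
    0x11e300bc5bff27136dfd3900738408dd25e601f97f6d77e97feec6fbe03⟩,
  ⟨!![1, -1, 0; 0, 1, 0; 1, -1, 1],
    0x39cfaff014fc0343feaf4fcb4c198908b1bea67fd9dbbe04ffc9be466fd407c3990801c2fe407b58195f0b793fc16033a7abda0c9a3e8f5071bfe98d07f4c151bf15700bdc,
    0x220fbd50100b54296efb2e3e94df95c823170866ffc70055a063cffefa42718f1f600f10f96bfcc4b,
    0x267ebce86fb173e2e910477e6dd0816c294bffe5c00e8026f7faa40163feadeffdabf8f6f8a28311efbe44333efdc5c13a001c9bd973fe1fbf2450a8d4174ae923c25d3047a7e986,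
    0xb963f4b702f8bf05700d2006f4fb70c15d7fe9dfe79e0045c087300133fa5efcc97e2eaf658ff70ef67a80611043f8113ef842bb9440417bf4dffef7c0882f2d5430980b3500790f576404380de4fe014010a8144bff24fd6be00fefdf16052380a47fadbfab2a03f7bcefc06287d123ffdfc3eed0501c131dfb88c054f08ccbd978f983407b4⟩,
  ⟨!![1, -1, 0; 0, 1, 0; 1, 0, 1],
    0x3ed7f03a3ffd660416c061a05ffbe22df4b9c1683fdd2c128d041c0135d05e680c82f8bffe03bfaac370fdf9e57ff4805e8be08bff7ec0dc6f6fa80d9df5383e09ffc0e8077c,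
    0xfef8bf88ef92dbe530fba8bf174fa0042400009dc1b45ff757f93fff547e82000c67f40906a2bff9404a1c04460b0e7d74aef1080a1b02093fd31fb0a822e70df3414f601b68126d,
    0x3ffa202bc3fe19032181ae2fa7c3f122fe373ffa00386ffac204f10005b07cd3f8b106394109df77ec07e10112feee9025b018d4fb7e403c9fa8680eb602c6ff4b5f0703eed9f26b002f9060c3e446082c40ce6f442bea59f88f804f604cc7eb7106727f97500d73f2970ca28093a07d201664029a7e489f9b40132a0946bfd660998bf80706e7400deff89c095b,
    0x3fe8afe52ff911faf5ffdbd008e3fe74fb7bc01d7fd377fbb3f8e1c2024039880782fcc5be9b5f63700660fe7d0107608bc3d86f03ad400910a5bc062cfea8c2111f9ff801fb09cf3d0c9ef1101066fd04010daff41c039cf9e9fdbae026601915fd57c169304028064000e6bf32dfce9bdd33f719c125bfe8c010f7f2d03fc31ef82404d202bf00571023d7f740⟩,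
  ⟨!![1, -1, 0; 0, 1, 1; 0, 0, 1],
    0x22ae00173fde5ff3bb007f8000c020a02cef0630fee6200e6c24c0f602811bafd70435e7fc183f2c1,
    0xb7bcfddebf69108a13d300fc4cbe388fd7fc01fb048e3ee6cf916fd613,
    0xa1f8fb177f4030796be61ffd21be62603cdc06bb0356405000dd3c0590099680e4a020200d21fc17fff3c059e3f02005957e2b9f6e0bbb05010bfd339ff9f80af107f7c0208,
    0x64920780822c700cd025e0f833bfdc7f8f7811e70343419a1fd83c101dff5efb6440db1800a50206c08d908e1ff54af00fc050ff95bc0773fbe3be001f7aabea07f5d200fe3068d41114f8cd01154ffe8c140d0071846d0fb64001f1feb07f986ec32413a8⟩,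
  ⟨!![1, -1, 0; 1, 0, 0; 0, 0, 1],
    0x6dc01c040accffe6c01c001c97f491f718c22dcf98e010be0050bf849f1b54265bf0db8252904e2c26ad08f7c11b908a1beb6801ef01b3bf7e8815d9073780cb2fa9d433cc,
    0x614603b9ff98e085dc089bfb8181311ff80fe2e1ff51be4c407653e8ebfe3b7d74e081342c7102217cd75fb57bd706eba581642f720c0252,
    0x4e00da7fe68fc8ebffb5fef03f8da022ac1580fe1c809c9fc1d3c987077ac1512ff774050e064440803fa357f72b048581e700166418160027c13e0f9fe004e502e6fd5b50380010dbf1debd8eef8c77fe310348ff0b102757f28e04487f4dc0201bfde1fefb80e3302a140c5bfec742816fd244162d02b77fa210b183edfa01493d9e102f0c03ebff34019c3,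
    0xa4fcf94041e01440075601b63f99e028200220006b80192ff703f8a7fbd17f4a2023c807da049cc1170fda7c1207ff88fa44103057f635fbeefca38048c7f3cafd0081bd5f4e0ff03c04cfc122207a500d30f6dcbf59afa5b7fd6bfd7141f85fb90c04dafd623efa3fd20c0f6f06cb00ad6ffd24101cfcf7bfc0104e9c1185fa390538100d27f0ff0155fe56e⟩,
  ⟨!![1, -1, 1; 0, 1, -1; 0, 0, 1],
    0x3f7adff877d98e010b405ca051f0326a02a8bfdbafef8810bd09d8bc1b7f9a8408d2ff8d7ea46fad240daef463013a9046efdf710511bf001035879690f7c93ba97fc65c18d9,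
    0xfe1080cfaff00be6770251019a0fb984143d06073f31500a63c79af225c1e85007b3e4a80579bd322fe74002490fbb01f21ff2efaa6e034bfefc6058644dabfae17ea6804c4be853,
    0x3fdb700d8beb64019d7ec34fc0abf96e036540cddfaafc1556f6ae40de20347c1d69f442bf0f0fe443f3effc313e1c9fc74ffdc0f43e41d16f44f4013803ba3fe0efb46c0745faac3ec51ff43408be01363fd5cffbc403a106b17efdcf824820cc040000c9c01abbb30c0383bfc6def7d80061fdde7f898056d3efb6004afbd530847be7d2fcb13f62f0212c0174,
    0x3fe9bfdf64085b0805c0d78044140afef74cc00c20360805ac01e881689febc7f65c072bfff290113401e6002fc144b0695c0331060abdc030043ff3adfb368093b03463ebd8ff62be4bdfbb17daf9f3853e919fe07be86ffaccbfc4205987bf75ea0a3fc0200d8c1e2ff93b424e40eec01447044fbf35300ad00e7effe98046b05a08156501d63f047fee440f1b⟩,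
  ⟨!![1, -1, 1; 0, 1, 0; 0, -1, 1],
    0x776dfcda7ec6bfb57ff806f2c57c493f9ff8051706383ca090b0bf9dddfb87c194f050d03c5efdd27f93a02e7007a4,
    0xfc7d00e9c05bc80d1b0686c1b82ff18ff879fcad80b260953bdc73ffdf8011004473dd470b85ff6ce03297f88dff4e41b6e01cb3df0fec1340c6905fe7d4c0eee981b5bfc80000f7,
    0x3fd3bfaff80504033f3f887022ec1ded0681c15360116bfb88fe4ec05b7f9a87f9acfb044000501ab3e361ed1afe5ecffcf7e847020b02419fde2fd9cefd503ee93fa5e81d6afb233e41001be0140302dffa63ff821be275032b01608023d3faaf01e63e01bfe123f018edbdc06b7fe1dbd0b7028b40ff00211b93e30173033e70400ffc28fadc4024204e03fd9e,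
    0x1a3dc10e504bb3f8a2fb2d7f05000c00111c0321c007c0562bcc5004137ec4efb2ffd0f6003e83615027781ad8fb913cfacf7373f4e8fb7bc17b902d8bfcc1ffb33b02ffd87c26c10417ffe3102328230eee89bedbdffb6c09f0ffab0092efd007f97f⟩,
  ⟨!![1, -1, 1; 0, 1, 0; 0, 0, 1],
    0x11a4201ff7e763f4fffcadf,
    0xf589fe03424c905f3fd71804f7c154d15557d871,
    0x15db30534bca96f23301673079204c35,
    0x3865ff0db05427fafafcf202c2dfa65fffbdfd1582aedf9d77f248f7393470dff7a82c960c587e9ddf649835b2⟩,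
  ⟨!![1, 0, -2; 0, 1, 0; 0, 0, 1],
    0xde906be814fbff1480608082f7d7c600843fb9bfaf6ffd48ff9fc0ab2f5e03fdea0133fe9b0fd81c1ac8f2f341539ef5a7ecd40a883fbc6002a82016010e7d80cff55be09e,
    0xfecc3fd3401967d500fd153feb30166c024c03dfbe1c2fe16bd500fe3241ab4fe93ffb6f113a7fba5fc38ffe73effefda0300647ed450730fd2c20152beaaef96e7fe86070ec0c09,
    0x31d002c7e89afd307e7f50079c029f061b3ebbf016d7df3afa79ffe98fd70fefc5f8adbf89ffd0bff1ef058b3ee53068ec1169feb54107bffa33ede902f6c02a9fb7f01481fe0efef930091fe7a0ff49818bf0234c36260db27fe4f02083d075ffb47fc30fda2003aeffde0171f094b40ec7ee018080d012d01eb6013901e0b04f9bf3b7ffb2c07b8010280df0,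
    0x3fd02fa4c80fea015dc0ca6078280a86fc3581160ffec4046402a64020902c400274068080536017fbffc1f947bfa4901ec4085ffb52005cff144801cafb370170e08bcbe7f402d90065f05b53efb3fb6380ac7ff9e7d83ef3f13d365022201a40f978bfff30690ffa35ff8041db7f7f3fd4a709467de9302157e90af8ab3f0880099c0ac60087bfbad03d3407bd⟩,
  ⟨!![1, 0, -1; -1, 1, 1; 0, 0, 1],
    0x3f68ff77a3f92604bcbdeccf588004af038740b97f0953e16afeccbed7efc4f0107c02f9c1314093280ad7fdd8fe3c7feb63f788fb65ffc85ff0e416c300d9be8e0fb5c7ed42,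
    0x2ddbf6e8023eff5100075ff050fbfec1377fc8a80c16ff4cfffc40044fee1605f9c3109ff19c0df409e17e58c06b5fe14bff22bde1204b6c15ed00a841f5d0176c045aff0842130,
    0x3fff5fe96006f00581c02a1fbbc00dab06fcfe98afb423e8dc0591be634fdba805df0686fff1304f4fecc803e8fd6effcd53fe22f44080f59ff1040a2bfeff81349ffd580c1ffecefdeee00948097dfed1816e201dcff4c4fe508101b0307806e304543fb1bfe52ff94102faffb2d00283f9620e733f5f8fe63c017d032e80d87005d001ecfd5c3e404fb3f815e0,
    0x1f20056c13a7f9efc0d3a0059419fbf5e5c13dc0261c0b35fd39ff665fea800575f96d80298fde2bf7490118bf2c90007bf4ab0f5bbf9e9ff7b7f7ddfeab00b59046a00677022401879fd67809a40ac2001b0f82fc17870483003a5f3a5ff63bf8588028a0154811390047ffb7afe79ffa54f3928032c03d0ff8a8fa1a00190fe5fc07f000e87fb97039c000ca⟩,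
  ⟨!![1, 0, -1; 0, 1, -1; 0, 0, 1],
    0x3f56502f6c0f8d0d2142445fab681816ff194086d00f63d569009bff218f5b4802790159007dcfac53f5d2ff97be6eb02513c721fcd28074a02eaff82e0f6d4144df4157f029,
    0x41f3ef58ff6a8277503acc00ad048a0097907d4fe6690100bef2e00d6be577ff4541197f4017fb09fd08bdda2fcaa3ed89fc934103a18bb7f9e6049280939008fbcdb4f2b63e942,
    0xd1bc0295fba98026cff26fe22ff7f180128fa070072e04297e51905863fc2f0b9a0123afb90fd8fcfd6c401bfffbebf77a013a7f357059841768003680269f9f83ff7502d4bdbdff621c00b3feb63f00f03540014401c5bf403ff1580ab901b53ef5f02de7f542fe293feddfb38f9ba3fe7f414100322bd6570851014290450420b1,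
    0x251ffc9fe6aeff39bed93f7c6014b8fcd8bf4650017c131804007ef0706463fb1dfcf60012cf74f0217cfdb3809f2fcedbff9d05b540145065a01b96ff70021e9035740176ff013e9d8041f3fdaefcdf814ac08aa40f8bff227f34dfcdb00b2804f481f28029ebf8e9018f03364fc16c0696fea7c08c40026c3b0302c4bef98f9c67fb25f07bbe3030ae2bc00a⟩,
  ⟨!![1, 0, -1; 0, 1, 0; 0, -1, 1],
    0x3d57826580f027edd8fc93fb36dfcf000119,
    0xa40b0b6b812c005eb0025df76201c7f04b780106f4f4f992a0024fc1e2fe53fea8b,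
    0xc59a0257ffab9099943b80fc58bfc40029676fba0560423cafe927fdb1fd5ac178f035c444980357011c5107981452182c4063804c48251c,
    0x3ffabfc8dff523fd4c3ed480197bf8b9ff82014a9ff057fff0fc9780200040e022d0f8ff00cbffbd64147ffcaf001b505d640e37efdd00c7bfe83ff90d000dbda0a0314809bafe8600106fbb1c1b7310623f1a8062e3c583f8ee411cc0e357f7ba0715c2b19f72086a8bfbe3fd457fa4cfee880125be0aefec27eb36fbd3010d1eb00fea66ee7f7b90ee5463e067⟩,
  ⟨!![1, 0, -1; 0, 1, 0; 0, 0, 1],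
    0x373882257f59e3e97fe7bbfdb3defd341a8a010876d63,
    0xc58c019b7f4680756c00a1f99e42eec090b3e5fcf3098070a,
    0x4b3640176fd747b618042b41ecffa677ef16de2d005010589c3dd5,
    0xccf7fd8b807c6fece42c5af850ff08ff2800245f0a324160cd97ec03bcfb9dc280bf366ff6f8f862424e31345016521b373e066⟩,
  ⟨!![1, 0, -1; 0, 1, 0; 0, 1, 1],
    0x632fcff80c32018441918ffe381f5bf7ccff2f8ffb5c2aec087bc1afbf9e2c1aaf0426c1353f68d4132df37100b17edd7fe91df9b6fb8a3f986bed59f68e3febbf5643e5b9,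
    0x17b8125201a5fe9af042fc040704d200a0cff2a40fd1f00ebd35efb7dfe20a00c3bf7e9f88c817ed011403dd7f5b584320ee41c10a101cc7dae5024e80877f56001adcfaa3bf694,
    0x228fd167ee8cf94e7f4bdfdd8c0d7d00e940c72fce67fb130099bf041f7ca7f0a9fb7901b9e09fc41af8fec40186efb5b4350afcd37ee6cf8363bc930122bfb0cfdbd40153f9743b49ef12c405c80427ffeadfbf0427f404e87fa8e068f403a202a5c1f9f07bc7f86c0472c0b840be6809fbf9097d24f01c481f22003d3fb5e00aebe93cf7daff4a2fc6cffd6e,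
    0x3fdc2fd4700b4100863f2990743809aa02babfeaa00c83ecfb07244054e0b3e3e13c0086ffe1a053fc1c38005e7f90d032b40577fc79007500882016defab640554fee4ff5d5002642e6f13da3f90bfd7880bbcfae33f8d9ffd3ffe26fb3941e7801b3fb1d7ff3f3f64af979be166ff8e3e8b808b443582f2ac00b8af8a3c0b6d000000d9005eac24f604c5fe79f⟩,
  ⟨!![1, 0, -1; 0, 1, 1; 0, 0, 1],
    0x2d49c05f5fc490012d0314ff436f0b3c1eb9f524bf1abf6a6c09bb,
    0x2e50c1d040ab4bfd82fe1c81a6cf7ebbe45d02b13f5cbff6a7f7f5,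
    0xd64f010701ca608464194d03f8bf7d90eb501c86037ac05090660ff7cafb777fa1c03ce015d6f589c07cf00a480622,
    0x21147f5ecf7827d94bf8c940be7015140588fd38bfd0d0527fe8190058007f3f65d0306401bdf8d0b007500282f7197f707fc9d00887f4d5830b6fc3c821920cac7fb4a029341bf001b4c12d7046fbfe90fea17eec9⟩,
  ⟨!![1, 0, 0; -1, 1, 0; 0, 0, 1],
    0x130ebfaff0237fcc46ff69006fc0b4f425bd08157fe4b04d03fe15f8ca80416028881b1e08c77e53afc273cf26fcfdffdd600d0c1cfe09cbc1f27,
    0x18f07f47afe36bdd13fef8405e7f7fb7c9d8fa9900206f866fdbc9fb70c17e5f74f01700f519c0b5bfd1100b2cfcadfe834fd73ff4e2,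
    0x6f9bfce4c08d6060a7d575fd1dffb340199fdaa2fbbe3f10cfb88c003d03763d90803857fa7303bc80ff901d9fef4ce3543e8de0238bf1cbff667e8cc03e13bfeefa347f72df42901b00054e3f5ad04e27fbeffcab7c402f7f74066d09af405ea,
    0x34f4c15e4ff10feef4fe72bf96cff9f01cdfff7580fe007507f7e4fc5e402be0612be32f077c80dff03fac0f6af8f28048c⟩,
  ⟨!![1, 0, 0; -1, 1, 0; 0, 1, 1],
    0x6fb0502fe15cf9067ee50ffb781c13003b00691fe59be1c403ed01914fc648144800a500a03fa46ff8e40be102d4bf8a580d29fb6a009a607ea40991039bc04bd055c7e573,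
    0xfb7040016fff3c0a3401d4405eff6dec2062fb42001490280c099601a940f96fb48ff661fe278007afbba4042cfb74409eff7fd7f2f4ff80800fc00c58070405efc0968ff2d7fe59,
    0x10a87fccafe21bf2abfd04bf2970114c0726fe5c8054bfc977e70effed7eb45fddb7fce4012f007a5fa81ff8e302d6c13a9fc17bef7e00a8fec8b017afdfd60478c0562028cffc07007f40816000dbf899fdac3fd5e030180264fa9a409c4fe22006fbffe1ff5cb00c23e668007dc16f0fe847f743fffb40ff2,
    0x2cbff56c07fff8d100082fc62ff5e1fa74bf0f5f76cbfe03faf3c0210f75f407f2016b00981ffdf410defda13f9bfffa13fe06ff970082cfd22bf01c0510c0984fc1a7f2eb0282415fd032e80e03fac47e87e0324c0c4c00f1bf6cefdb2002cc013180ae1ff85ff222fc5affa2101c67f07c03833fbc7049affa99fd85c076302bbc057af9093ff2fff087f40d⟩,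
  ⟨!![1, 0, 0; -1, 1, 0; 1, -1, 1],
    0x511ff19ff593fa46c0916f298fe9fbfafc40776fd8c00528f73dfd68cfca4801830092bf134fea7bf4b2fdb77fe2ffca0009cd0788020e10190fedf8022d81c15f71bbf300,
    0x138117efb483eeff0a6141ed1fb70fee55f7898158efff0405dffb70c03540e6ac21bb00cbbf05102b6810c5fd9e3f02a0409bf44102beff0cbfe78bf39102fe01e11032241428,
    0x3f63fd220084200e7ffad8f88abedf6fd613fe83044080eb6fe75fc2b5fef6807b9f86901b1f00ab8021e042f41ba6019e0106c06df3fa4e014c42f13fb10804e0f92dbeb1d007a800b109d57fd45018fc0e44000441b1003168009800b5c002100a9bfdfaffc0bffae028240418058ac10b90246c1a4604e50082e,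
    0x3fc7c049f008300201408cffc337efebfeea3da0f026e4004301ddbee4402c60015ef5c6bf05cfc3c3e522ffc9c21b100bb3f975fb157fca001e84005bfc1c7f03dfeb97fed6fe10003a9ff23fcd71ff49bf7ddfe5980e1a013c7f82bedc38040a0054ff89500ea82c90fe2080903fe1a8005a03b27fc28feb040107faa680ac9fd6effbee04997da89fa8a3e9c9⟩,
  ⟨!![1, 0, 0; -1, 1, 0; 1, 0, 1],
    0x3f974fc6f7f86501d080b5304bfffd5bffdabfea4033840574002fffc9d0029c017dfb65809c8010f40933f7887b3c6fe1f3e44c016f01014006fff4c1fecfbe737fe0f40c7d,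
    0x66dff9c00616c1db8fc6fbe07e08ef3f751fe7e41a2202287f4e0fe543e2b60614004b304b3bf3510631bfb05fdbac004dfcd700b65ffd9ff74ffe747f96000e4bf420fb2380f48,
    0x1e3fe8441c68ff1dc135c005940d7202e3fe30bfb9180459f87a4097c03873e291fd414038efed67efb10450bfbd4fdd8c0c9b008001703fc4140019074fbee6bff477d6f4083a8156100d73f756ff82ff857fed44010dfd077fdcd01af8109b02a74019f01bc7e53dfdd5c077c082000a4c03b9ff53c00927f91cfdb2c1247fd9fc01520433fe55afecdfdf27,
    0x3febbfc89febff04b9bf28c0651ffcd206f241a8003bf3fa45019e010c0001d0162805c4c005200423fad50166ff40d0079ff6a0008c3fa9cff950067ef7d97f37a056902fed04197ded0faffbef6d0502c0528011dff4f5fb318132bfa087f113fe57bfabd00e67fd2c0118bf436fea5402a6fcd04038bfd29414cd0459bfaecfc077f83903a981a16016441b9e⟩,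
  ⟨!![1, 0, 0; -1, 1, 1; 0, 0, 1],
    0xa9b807c8ff64406ac09503d847f6e1018110b6e7f5a3003a3e348fe24fe87ffaacbe0d702aeff9af08543f0d306424120efdc93fdaafd7d7fc63faa17f4aa02923e2e3,
    0xfeaa4067104644009af8ec018b902667cb5afac1ffa29fd07bf3e5fe98ffec1f5053de8bfdaefe4ef04c8418bbfb5300127094c3f8d8f9fa3fd03fb8c7f836036abf050fb7a3ee18,
    0x3fd5f001f7fec3f98bbe80d02b1ffbaffb5e0051d026900e29fb69c268304934081ffd72802a6fcc1c0343ff9b3fdf60492409d008efc17ec0302fe90ffc7c3ed8e043e3f11df56942413f67fbfc9efd91bf816fbf0808adfdb67e7530175ff7010357814b1016fc02d7f80e7ffedffe6ff9c400a200155fc32c115efada7f5eefedc7fbb3059ac12a4fff8fda91,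
    0xf15406b2034a3fa12011541940fe92c0a050207c04fefb6fff6b0ff07812380072ff419f328befd304b782b9eff41403dffe99bf81500c57e5600999c089afb1fc183f055ebe55e020cc01ae001dc1ae2ff28ffea5fdaf3ecb7065500b55053800921007c00d37fe22bf87b03a2c1192ff07bff96f9837f941001d7fd6b⟩,
  ⟨!![1, 0, 0; 0, 0, 1; 0, -1, 1],
    0x3ee04ff24c062002b97f652026cffa14fd464067b0549bf31afe127f178ff8c0083002fd7e04d04680006c09f9ff32a026aff69b01c6be709fc52c153df9c000271fd687d7b2,
    0xfe4ec153500ea4178dfa30c2c6ef96d809c601a17ccfafe29408d2ff50bf8e9ff82402d0fc4bffde20444bd98b05703f7b701f73f02608d5c19620154ff6840069802ff05a7ffc9a,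
    0x25fe01c5c1999fc02409a4064effd640777c0452fff0805c500b30089a0053bec23f8f9ffbf602fc3f996006f00d4afba34035f03b6c067302677ee96feb53e83dffa4c101ffdabc116f02a5001950031fe4d806a6bebccffa543c1bfd0800602005affb95fe687f957fe304162b016e3fb5b0235806af02098226000d07ee58fca93fe3c075101ad9,
    0x2fd05063f44602d9ff4800092bff7dfd21fedebfdbe3e37aff8eff914fc487f891fe65be8be080d7f1cffdbc80241065640c2705187df27fe7c3fdb303d200d410357c230302e701345ff30ffd5104f4801d1fdf78180ff13b011c500d73ded0023f3f46701a68071704a6000bd015aff20ffee1ff67b077c3debcffe07f0c200cbc1cf5005ac0621fd42bee38⟩,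
  ⟨!![1, 0, 0; 0, 1, -1; 0, 0, 1],
    0xc9f90786024b402467ef1ef6a97fa8009adfc21b0b6140480,
    0x2b50814700c1efd791fdf63f1bced8300309087ec3309f06841c6c02090087d,
    0xbb50fd93ff221fdd94322bf2d280bbff407012cb07dcfae4df433407bceb8c40670ffb37fa55f05902d380a11ff8c204937f016fe257d5acfcac00332,
    0x238cfed10fa287f5f2fda7c101402e37d877f328fb417fc3a401220431bf62003f4bdb3100f17f78d0036c29a6fa053dce11eca812d6112bbee0603597e3d3e74e806e30b47c03a006227f89cfe58c06b8⟩,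
  ⟨!![1, 0, 0; 0, 1, 0; -1, -1, 1],
    0x20657fbdd034d7de4cfb3a7fafdfed88154500233e6a10bb6800d2ffa1410b8fe2d02068021dbf2a7fe9e00c1e,
    0xf9b57eb31fcafbee5b0656c1b5ffd61bf432f8db7f244fe6dbface0a31fe92400ebffa0703e6c1e52fb54c1203fd09c1c02002c3f0be00a4fe8a204b4be936fc2b04182017081026,
    0x3fb3efbdcc1950fdc9c0d460110fe5ce07c6bef500243ffe3e02c0ffe1705b040811fbe04126304f300fe509d5c1215fce87f6c5018e8147ff8a6bdecef533bd5b5ffe18125000477f61d05b90075900c30234602de7fd2cfc543ecd400b8c04be015e3ec61043940bc4fafe3e945ffc9ffbc2f8f43efd004cbbfda6fcdbff48000b840337012344de404c57fffb,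
    0x22000d100a57017000a2cfdb1008bdfc1c81a6c018afe801ff60c05f301f580a8bfe1fff0baffb77fa2bfeddfe85701fd7ff75089f407920742ff25b081840d56032e7e48c03983fabcf8053f3d8ff840057302eac038501c04177af64500101fe66c0060fd097fee103a8406640580002b8fa64bf5bcfc51bef9b03b43f1ab00593eb44ff0ffae92fd8cbfc07⟩,
  ⟨!![1, 0, 0; 0, 1, 0; -1, 0, 1],
    0x287b40576018a824a1f53ebb5f000503eae2fb08c00cff6e9bdef9fc43bcc57,
    0xffb9c04e1feb37e4d10091beb69fd83440a1fd378076502ec8375801ffc0e6b02b3ff5570101f9583fb503ed85f3d4841c4f1f5be193f6234207a003d3ca70ffd7b94d1021ac0859,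
    0x9212fbe4408e202797fd01fb9dfe60e05193e28efdb53eabd03dc83e0608d481f74011841aeffabac35fbf2f03a32cfddafe9be0066804f4feaa40c9405e07fad505e44190305e9b88320955fee84,
    0x3ffd304627ea02fc02fec01fe20ff4b301353eb860452ffcdb09b27dffa021bbf646f65f8172c02e57d8e7fbe680f4601627e95f0182bfd24fca7016b5fedffa83ff95b403a60108c0b40081680c0cea463f44003ef01ad6fef13abc8fd6b3eb60fe1b7edc2f762bd11d0635c319f0b534048105ecc062a06dbfdaf4f959bf36cf1cffdac20113869a9ed394191a⟩,
  ⟨!![1, 0, 0; 0, 1, 0; -1, 1, 1],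
    0x576cfb4f41e54f79b4022c01c8c28fcf19dfe5f8084100895f2d601fdcf9d2bff69058880bcd0292bda5ef0e2409f5fc8cfda90f8c0fe07d,
    0x3b1ffdad7eae7f7ccbdcc8fd65fec2f0bf64038efffa4189a0013bdda4017b82153fd6f017ec03e9fc729fed441822fe0e7e5fbfd547fea9fe3b80ad9f157ff01b,
    0x25605a20021801b98055ffb237f0fcff0bbf2b80261bf8d001224014dfbcf7fdc004c17ff8cf980408ccfb66fee610326bdac6fd703f827007ac19e201d2fc31a025a0081205047eea201380078d014c7ef4cfe8cc01b8fab2bd89afc88412ecff003d9ccf81cc0713fe8a00f0af45d41504fb44ff36704064045204ed7cf780697fbc8efda6ff7a4f1fac1a9b,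
    0x3fee0fe94c1bcc026a40b5302d5001af0689c1eba06c13ecbffc49ff867059ec06920a61c08af06d04067b034d011530015c0688fdd3c1c970299016c504d3c27e703293e719fc6c8131d075a7da39012380c69fcb67f64505b6c49bfff96008fe0333811cfff557fbb3fc407f96dfd0e7d84ffb4a80f9cfc25c0036f7104010bf48741f61087f41649100c7c1fa⟩,
  ⟨!![1, 0, 0; 0, 1, 0; 0, -2, 1],
    0x153000398096dfc217f4fb01433f7fa09e6c2c5f005c0002af2570186a07e780993fc59c09d7ff17ff08b039bfe2a6ff387b4bafe7cff5b70828c2e9af9cbbc90f011dbf3ec,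
    0x47901b890190803a6ff907f0e603f9bf7ab04f28199402f1fcf0debb001213fb58bfa720900c053d0968fed1704a3fe6d4fbef013bc0777fde4506907e67b052a7f63205b4ff68c,
    0x262fba0fe7beffeebf16ffc02c143bfa2900c60fbbcbe54905d6bf0aefd5fbedc0063cc1b9eff6f7f6a3f5cdbff48071800e66fcf23d1e80066c0e260292be29403fffdc44fa21405e900de80bb0f85d7d293fb6300046f87bffe32ff2b3fa9a03258190602dbffea106ef02f63f7d77d72103ad7f76bfff680aff01d2030fe05b3c14edff3340bdb01fe80bc9,
    0x3ffdf0180003f3fea80149e0294802befdb6bef3b01a4c113ff6edc0832fc68ffa8dfd7fff0b7fcf27fa7f08ba809a6f75e7fab1f9287ea78ff1500063069142005fe57bffe7fbed3f109fdf1feacdff6b80c4afeda003c6ff7dbf7a307873f67cffa9fe87307c6be871f989fbaf1fcea4347a051ec1015027800f06fd53beedef003bf7430089bd6effb477ee10⟩,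
  ⟨!![1, 0, 0; 0, 1, 0; 0, -1, 1],
    0x15c6dfca07ce66,
    0x13b7af3c88511700988036d,
    0x44db42d9bf995bf880fcd50178efaff7d7a1d65cba03efe4204fcefb94029dd,
    0x5cad42e68070f78b9405c97d570⟩,
  ⟨!![1, 0, 0; 0, 1, 0; 0, 0, 1],
    0x1c8bf,
    0x6e2e3fee0,
    0x18856f3a93eb33f060b69c6,
    0x1df1c⟩,
  ⟨!![1, 0, 0; 0, 1, 0; 0, 1, 1],
    0xf969fcd5fd08cefee7d1ab1c48807bd,
    0x10f61005dbea790c5b8080ae352fc4f6,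
    0x12e350353ff2e2020f7bcba0198bc632018a4091ff6617c2b5,
    0xf09d015000348f961fface062f3f46cf556b68f2f09c7f4af01aa80fc8ebda002a8f5883e2d4083ec5d54⟩,
  ⟨!![1, 0, 0; 0, 1, 0; 0, 2, 1],
    0xe15fe0c3ea79f91901078fd2fbf0790551be822ff7f40236fa4b3e15b02b2bfbcced3ac07440332fd03cfae33ed1a093d40aeefae87b9ad0616bf3ea0c43c0f0afdee7fca7,
    0xff5e7ecf7039700d1a0486bf961ff60404780509812c0eba63ea580a0e7fc31fe9afedff08508097701aaff6f1035ebfe05f5ddfe8130404bc5cdef69feca1f3b4002f0f6d60085b,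
    0x3fc0cfa4a80e37fec2bfee20792413e302a700d19052d4134e0023bfcb700a480967fc66c08a90cb63fa3efef7c03f5fdedc029afd01408d102713dc31fc013f385f2403e4c7ff46ffe3e092d7efac0174001b1fdb04283afa6600be401a141107faadc107df3ce00a56049a405c9000bff89b01a3fa91bf93c01ff2f37b40556ff8dfd19bff52ff42404973ebf5,
    0x122ff0fbfd27012380510029d0004702c6bf390fcd18054d057040fe3f7cebe39bfdbfbf9b3f51ec035cfe98c0d35fd047f298011c8014efeb5c07750569c1cfa06ee82573ff523fe7cea6c405d3fcd58177cfe2bbf9fdffb0ff346005280fec07bdfb4ae030c40857022a40678017a01c48fd1581d860fe04100606718036007680094c01a941be9fbbe80b31⟩,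
  ⟨!![1, 0, 0; 0, 1, 0; 1, -1, 1],
    0x30fdc3ff1b6ff217f42702d6be49ffd00fd230fe4e42703fbcebf05503abbdbb0f95ac2c75fc2b8065c0f237f81bff217fed800f03f57801ab7e17f054e3fe85f37dbd71a,
    0xfd040033b00053edfc019282f52f7ae7ec6403cf4021dfcc37fd10f5f342b2607504103efb143dfcaf949c1b2004347fde104324192afd75421790018be982055a7e366f5d243003,
    0x3feca02cebe4c504e63f22c02d1be731fda2bed22011e8045005d7c26fdfecffe5fa00f87f8000648c139604ef7f73c098f009d30460c04bff905bea5d060780b9b02cabfe2b05f3ff16d07c3419bc04c47f7bafddf7f756007003310fbf4fe66300b800529ff823fd29fc89c02a4f5f602b8303b682734fc103ece8051d818c600597c6f40c2dfe4e7062d8241a,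
    0x3fe26fe9ec0dd30004ff41dff85803e4fff9ffd0104303ed94fbba803b9003f01cd7ffcbc091bfcbb3ea3ffe0afe5f7f5d0411affc3e3ef53ffd4c081df897ff736fdfd4133307fec0599f52b3f66ffb1d41b9bfe17ffc0609f83d6ddffb5c0263fae4bfd59009380c40fd2581691f979fd2260092bfd37097e40e86045ac1aa8012d007ba036282664ede9ba782⟩,
  ⟨!![1, 0, 0; 0, 1, 0; 1, 0, 1],
    0x90baffcc3de9efa627c7cbf744fef83f5a7006d3032980a52f51c444ca09a1c248901723f3e3,
    0xffc02d9ff1381910fe11bf08c075040f82f5697fab6fc2c0376afdac7a3df013aff7bdfe0780188f43cbe2970258bfa0b0178bd503f3a336a92020c012700462010f113880207b,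
    0x1e10123ff4d6fd9bbedb7ffc07f89afe0bbd890fd017f7f6f54efd8d0fb2080937fead3e862f83202a10094ec0c92f54dc00d3ff6c3f6bcfad00259dfef700f68ee9801b30f9a980f2e03bbc13c9fb5a40831f20b3d24501f7411db01554029af3f3c1292ff4dbf2c10133ffc5f06a0793f9f8807c37a05e6004600158fe6bcf8f70316d0cffc1ab00394001dd,
    0x1cb180d7b068802575009902c21fd7d3ec25090cbea8401e4fc869fc9eff36100e33eb92ec8541930f9f50052a030e413f807baff3f5f4b100a6e04e2ff697fb3744d250ad0862aa00cdbeb0efce33cd7008f03e8bdfbc13d970fc507ef11⟩,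
  ⟨!![1, 0, 0; 0, 1, 0; 1, 1, 1],
    0xab99f7040195efb5a817b9fe25c21560d503eea5fd1381201ffa23eb77,
    0x1c57beb4501a082190fc3d02707fc2880ccd01c500e71f70c40aabfde2414c901bc40d8c07907f7a4f6cd7ea0f06a03f401,
    0x25c8c0b6cfb9a408bcfa2e80327fb30c0ceb00f6406af09287f93e000e00a050bcabf87e0c5e40185f198c090f00dd0062b00d201da100473f0ebf8f5413f8ffaf00893fa213eb99f9b881b3a,
    0x1854bf83c04ba7ef89f757412b6fcb5bd68c052abf691f93b3d65cfc6bff7a90254c24a6093d015520286fd44701a83fbe806bfc1bfcf875008b4efd0c2f940254c0122017f400ef039fc06d600a43f5cffd22bf4540dccc0ac903f0c04bcff3a81348fef1fe082⟩,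
  ⟨!![1, 0, 0; 0, 1, 1; 0, -1, 0],
    0xea1c225c005abf7e003497fe48ffd57f10506a4ff47a04223fb4fff61807b100c27f107038380dbf00113ee15fa6aff6080334ff8e002f2be2b601ca00e40,
    0xb67ef7cfa52802060083be66e03707ed40feac3df49ff037e85801bd005f2065bc1fe2fb153e80304667f7f101acc0076fdbc40c15fc513feb003c9bf0a500b33e6c6fa123ed0e,
    0x2bf00ce3e251fc2cc08d904c9c0c2bfd0a7e7e7fdc201259ff187f1bc01d9fe8dbff437fc9a034a4075003a53fefaffc3c0142ffd8bfc86014900e4e0109fd613026540fa1fa7abfc20fffb3f63bfff3c1c5efb277f42eff0a01105fdde3fdbd0038804a80078c1913018f7fad0fa6cfeca7fb22bfccbfe9e3e4d200dd7fa32019180414fb63bf58dfc2a7f92e,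
    0x4301a2c0138f8debf14bf7d940510ffb440ef9016d7edf9ffc7c07dcff64ffc1d03523ee17fb13bfebdf82640685fa9e3f7ad02a3013d8fdfd7efd7fd54c00ce00b3bfd7504c37fa5803683f753fb9ebf20a03c77fed10231ff19cfa503fb4f033ebf7950225ffa6afe2e406ad04a64148a04563f9fc0465017e6ff9a805d6fb913eb380649005be019f7fd46⟩,
  ⟨!![1, 0, 0; 0, 1, 1; 0, 0, 1],
    0xbe8fe283f5a90368409c6f66001aa5fd8400db00b63c0d0df770420f4f8ce3cef0ffe8c0ce5063fbea1af05c7e58bfe3382458ff01fd84e11cdbd51a0cbe402dd157d419fe,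
    0x6a34ff868202dfc0c3df91034b7f3f4f000c1622003d3c983ec227e428fa398312eef26839f40835c1333f4e8c0de70de3fd3a8,
    0x3fef6fc17c03d1f838ffc30ff378189f00400163c039cc122107477fbf008337d4e1ffa3bfcb1fee34094c0442c0f48f7853cb2307af8121e045f3f568069bc0faa02acbd5c102587e18004b1806d6f96efffabfc4c81a77e094fbf98fd44fd509f16b40688f4f140484f8267df67fe1a816f2eeeb3b5f0f86bc2a1f11e4c2496f8950122e0a2e7f819ffe8fe1bf,
    0x3197fe051ff9401a8704b0c22f50ee1bef8d11eb7d9bbfe71fd2d4130bc2108eeb93d9a5061f3bc380258fec29f8f280e50f799fdc95⟩,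
  ⟨!![1, 0, 0; 1, 1, 0; 0, 0, 1],
    0x3fb8ffedd3f618fa8bfe9dbff0fbfa8207943d9b5fed9bf45afcb9808490a5cbd6b00c0f3e3a0f6447d3cdf694be40efb4b41740fb6d7fae008413edd800a17f7c4ffc2fe45b,
    0x1e0bf60f07b2810b8fe5740249fc813b1f5fe72001590147bf28e01a7bec1dfc83012c80721015ddfac97fcb601bf019a1fbe3fdb27fed6c42bb02a70154114aa7f90cfe253fca3,
    0x4e90f8a7feea1002300123fbaf7f08706737f834fbdbbe1f9fdf3beeb90228fedfd04e440995fc6583713f97dbf3600ccd02679058500223fc9d8037efbb3c2577f9a4404fbf8e87ffa301a4c03da045a4017a03c03e6d102313f7da08b6c122ff56240beaff840125efd13005b0018fbe7c3,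
    0x7536026dfed33023202107f85580be401b1beaf306aec0d67f8b7fed8bf7c2bf8590cb0c0409079f7e6fa038c7ef8b06d93f32004a90025b01877e4c8fa7a7f38cfb5b7dff7fc9b3f385fce1c041f04573cf4a0007fff1201ca81fbd⟩,
  ⟨!![1, 0, 1; 0, 1, -1; 0, 0, 1],
    0x3f7fcfc9b80fa0f97abc45f003100bd6f8de8289e00bd7fc0afa7fc0f6a0a8fbfa0af60700fbdfd47fdc1f0bd2fce7bf70f7d426003000ace0810c315404de448f202d300104,
    0x1f187e74c02be7eac4fda701d5bfb517e7d7f44abe3e3092340c740219804a100523d4c209083f862007b404a0,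
    0x1258bebfe00a87fcdf0880415c201f9c018aff51c1e3e05b7019210326fc3de0d06be526fb4dc1a820c4d7e85dfecbbfced053b4131c013abc229f56abd8e1fd993ef6e01c3bf365003dbf207faf1bece7002441e3f0a76bec57fffd4036e009bff6a9fe6602254fa04c0332066d408cffd8e7f465,
    0x7d71fed6ffc2bfa49fee75faa841e1d013c028990519fe2130413c0f440a9b829d7fed9008d3fd75c32b905593fad9054f810a2084340b3df63abe50ef7e140672fd537f3e805bc7fb88f8a200262fa23417b9fce7ffc94⟩,
  ⟨!![1, 0, 1; 0, 1, 0; 0, -1, 1],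
    0x4508001100b6df8e5bfb09087241195fa99801d8fd50ffc65fda900f41fbbec141e03cb818df0510fe3b1fbaa7e7af09400220cfb64b8f66fe2d810e1,
    0xf3fe04c0937ffeecf96b413b705103f95a0ae18182107dc00270ffc7fe244fca63f36bf324bff36fc947fcb0003701465f1ae3e7bffc57ff6ae07507c4df05644037dfad700c4c,
    0xfcffba7fd2800d1c0172f999001eafe08006b0fd18c009bf9723e380038dbf47aee8c7f3b5feef3ffedff534017207ed3d49bfce2811db037e40138fcd3fe500fd32c3844fa8abf31004ad7fbe0fcc242b4cf9fc3dc3405bf81b2e0360bf88c007641458fe7980386003480334f702fe4a6ff323ee51045b3ef6b01c181aab0f363f8eefe8600420fdf27fe40,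
    0x3fff70105008f407774006804cc7fc5afb14bdf3c000d7f26502c180c8efebdbde46feab7eca5ffd140b48015b80277ff7640e1302b7c053b02653f8a2fe0e0383d03d33ace0fc80c0c2b00037ea340213be3d1fd03c218f01e43f8f6fcdf40d1602913df010347ff815fffa7dc720180432bbff7f405d4fdc2ff67402d8bf358e5837f134fc5dbf4defe54fe810⟩,
  ⟨!![1, 0, 1; 0, 1, 0; 0, 0, 1],
    0x9f9afbc14371c051e3e73ef80501744143bfefb2f7da3ce5ce46302deeffe17d960,
    0x522801e1af042bf6ff,
    0x41a97e79f08a103f79ff367dbaa11bd40f64e74dbaa2bfd397f8521227bfb53fc89804d6,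
    0x51ed42eb4f1e3429d3f1f14120f04847caa2⟩,
  ⟨!![1, 0, 1; 0, 1, 0; 0, 1, 1],
    0x61a703a3420bcf7babee1fffcebd163ff14fe255048fc2e3400e2ffe72063700fb3fb587be9600167c199062a81429f8c6801cc,
    0xff063fee0f64afe26afa36be4a503bc3f01bfd857ef4102414083103af7e6a7f89cbf391057effc1c02cf3d77e04ec01150fb0dfc392035f7b777012480177fbadc0f2df65f80858,
    0x3ffeafd0f01abcfa298197cfe370122701543f941fc1dc035906e14193900fb3ffc4fc0a7f596f8b33f74efd8e002f509107e7b3feb1c0fdc055001271fd1e7ee900160ff439fa173fd2001fcbfb6ffd59fe7d6f44b0005beef5408bafee1bfcec000040024fb0e405f8fd0ebdf99018980b3fff19bac95fb0701a3403157c863fccafd407fa953ff3407cd00c3c,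
    0x3fd68ffb3feb6b0276be8c1fe19ffa62040b3f81c00d07f81efcbb3cf3c06ebbf27d0095c192606038051a01593fed0ee7501199f9447ff8aff53418650148c0d21fd5e80505018402aadf5eb801360106418020510fea050175ff89c0514c0a2bee8abc58f06b8808e9ffa701f4501ac3d515fa03c30bf0c4580820f77a82e8c055c00f3406ed810330099be2a0⟩,
  ⟨!![1, 0, 1; 0, 1, 1; 0, 0, 1],
    0x30c301617e549fd343f9f402637fe3bfa42416db041980a5908944142bf834bfb84000f80009f6fb41d76fb1c00bbcf9a1c520e00e9be1570946ff77c04bcfffbc,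
    0x19fc060b0440fd0faf777c1f59ffb83d8deffdfbe7fffc2400b29f8b4bda5302f680345063dbfc43fc0bffbbd01b6005c50483bf02cf8117f1dbfd79c016bff85ffe7eee8101060,
    0x5de7fc4d7e531fca97eedefdbc3fcf7ff117fc6ffa153fb120307010050219016d4fb97ffc24ffb5bed38fec0ffab2fe0dc167001968062bffde3f1ac095bc05af02e0805bb03cd80b8fffb67fa9e000e0142dfa5a01ea7fb44fd4b800963f2f9ff220019dfc1cfcab8,
    0x30c0069fef35fe9200341fe273ef03fe0a7f202003ec048800dafe0c1f85741596047d3d585020b80c5b001800c4601958182f01908007ff80e009dc00a03f81f00af3ff4a022efff1fff8701b7f05e1418f70231bfd67fbc6fe5f702743f707f3cd3d8b5fb37ff76cfb247ea1200fb40b520070be792f868bdbc0040a8300a01157e94d02b8fffe204babca2a⟩,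
  ⟨!![1, 0, 2; 0, 1, 0; 0, 0, 1],
    0xf07ff5000a55fdc504097fea80109c0775ff1f603958066400efbfac1f864becf604a97ca6effe440b310037bf1910c21c08e6faf6c06e107ddc2373fbbc7efe3fe250103b,
    0x4487fb20fe0b8023f06a9fd64e05427e622f68dc1cfdeca0007c8f506ff290fa044088d091580940f781804b30632bfc01fad17cb160148c213cf510fed2ce9a802431f59ebfe08,
    0xcc0133c0184ff48bffe6fd697f617fec10066aff20bfd32f51b3fc6905bf3de73fbe13eb0dfc68feedb009a7f1eb096d3e60eff60c1b2701de43bbdfb68ff271f29202ac0fc5c4081efe597fa8dfc9bff2ef037900a13014a3fe770216fdeb300f33fc24ff7fffa46f68f3f1c3ff6e3df9d06d5c091c020ffebd70ae34194902597fe51f7fd0058b031f00462,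
    0x141004ec0150fa320098402a17ea02072900433f6f9806e200227fbf8fc4d8058d018a014fb06ec40b16fec6fe51af2b2404fefe443b89202f5bd5b7f7e97e2c2fa8dbcca1055bff64b00e98112205c6c0279fd3d3fc82fd437fdae024a81960eed6418e0f901403c6021aff9effee282575ffca00479fb2381101ecfe3f81a050afe5b103948165efd5e7cf6a⟩,
  ⟨!![1, 1, -1; 0, 1, 0; 0, -1, 1],
    0x13b809158161f04c8be4c8076f7f5810db3c1a4ef6adfd740fb13c00c2fe897cd44f921c0a1f02ffbed330679bf514f9b90199705337f60300f246fe4fd5efde12ff133f1f3,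
    0xba4154204103e803fce1bf4a4fe7740e2304b18135efe213ead8fc2dc1c9ffbb0811ecf3573fe8e03cd3ef350034fea10056a3a0e4f98a3deb80118422f402683cdedfec4feb99,
    0x2bdfd0eff773017c7f1fbfda17fa6602c6be3d8f5953f12005b23f0d9fdef005d2f8a93fbbf02c33fe0eff32bf4fe0d11fed000a52be4ce0419431d100bf011e10464411fefffac0bfa0732fc70803413e342feb5c19270e96ffc2e031ac14d6fad7010a9fb14c21d5fd39005320c0980e9bf449bedbf01ee41dbbfd7305c7d04a38188907d03fd7afe894099b,
    0x3fbd60028bf13705a1414b301c4406a8f672017e602c8014c3ffb4414ba031dbf88e0492c113affdfc0b87064502433fc0040c14fc7980e2dfabe7e6a50ad5ff164fe0f01635fb847fc4ef57e7eeb6f630000d9014b3e7fefe30ff74f01707eb8eeeb97f7ba028afbfcbffbcbf6b3fbe64080804bd3f74b01913f040fee83c26af1f83dd8af74a7ea80fb257f1b5⟩,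
  ⟨!![1, 1, -1; 0, 1, 0; 0, 0, 1],
    0x3f7b0030c3ffd7ffa2ff6fef7ee7dd020d29be785005d3d396fd43813390671bf11504b53eb4d05897c71d076f7f37f0dcfc4021026afe748f3a63f92ff346bfc300069c1da7,
    0xffaebfe78010442229fa52ff553f5ab408160517419d50ec5808d4004802c34fc06fe39befd5fc8790b203ebb9fc453f2b6060a808b7fd92c1507ee3101c2609c9fe068fa26c0143,
    0x869cff3c8019908b7c04bc0c4dc35a00971bf0ddf8edff465026e41791028f3f905fdf4822dcfda082028f28c40fa601ed7ea37fce141cd40afac1cfe05e1009e502723e78eff64c1191fc4bfdf5302547f943,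
    0x760596ff5ed024640b7df81f8065dfaa54002804b2bfdfd041a41ccff787fff6ffce8beaaffacb7e9c4ffe9c2fbdfdd5bdc14011b3fb6cfdc27d0760e280180fffae42e2cf595bda3ef4daff91103c7ff4cd0025be0fa049c423480024be29b01073e3eefe063fea2062600ad4ff837def1f9ba40291f509c079dff403f63905fcfe479020300f52fc29c3c6b⟩,
  ⟨!![1, 1, 0; 0, 1, 0; 0, -1, 1],
    0x3f72ef8a3be137fe7b824b1f81741f70f95f7d69d07bd824eb0844bd753fb1a3faa200e03f93afa15fe8c108617f349fee3c0733ff3981048fe94c20f1ecc3c249ef7b082943,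
    0x479c040300c810928ff5b70b9980bc4fc7ffd87c06210040deed47d2ea034d81b3c068a7ec30062743eeafcf7c07b8ee888153dff958001b06d182ca6,
    0x7e27f509fd937feee00e5ffeedf8b8c128a024a80515f971c04f00c00bef6b01553e3fc000d7f7b3fd370125ef94982b6ef984c18d509a5ff21dfb9f7f9c8fb3342086006ac058ffcc5c133702e17fe770542be5300539c086c01e7fb43d01553e2deed7cfd4ab04be7e7b3fac24074703dc819fd0bcdfd4ac01af40a9afe15403fcf9eb010c7015b40f07,
    0x55efdc8807a8ff0d7ef4100007fd2c03957e5d6010e3ff4402fd81820f2073f8e0fbbe3fe93f5f040b320818be39c05dcbe6fe0bb0009d3f7950086307804342d0a353d219ff737f9110bfdc1e84ff518153d01c7c09cf05667fa80f7b6be3880d9cbf50702f9c203101ab8141104147db24012afd9feeb7e00c6c02fe7f582074bffe4907d6fe8fc038340132⟩,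
  ⟨!![1, 1, 0; 0, 1, 0; 0, 0, 1],
    0x4c833bc5b129b3a59d,
    0x47523e30d06d77f250f5fc83ec5,
    0x3ec982ad8f9377e81f036e3f126f772805a0d4567d8d105e47f4850a973bb990312025a0fd75c085d,
    0x4e977f577080ac1170f1f5c1643fc8d3b24605c1fc009⟩,
  ⟨!![1, 1, 0; 0, 1, 0; 0, 1, 1],
    0x2687be5a3f58e0106300537fb8af28ebf6cbfae10249ef29ebb9dae6b9ff2bbfc41820a8,
    0xd07bf2b2fc00424fefe893f69d030d7f2f8075dbf0bdfa5f3cdc70427c1b75f4f0fee23ffb4fe4b5ef5181daaf6707f52df78ffc7b4e2fd81cdd00758081b03df3f6e6,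
    0x13102fcbf5b903217d554fd093f963fddf7fba206d1ff7d3f5a53efebf9fa3ea6401f77f91401b900d9b0906fffee03604395b08f600508fb6e4018ffe65c18a1ffa5000e8fd0e002e3e87e7f988fa60010260416fe8f90aae7e3ba0231432050330fd4b7e400806d3fae2c14500014c18d405c0fdb4d15698177e01597c98cff014144dfb753eed9fe51bfa43,
    0x2a1c406ca05823fcf2f817c1515006801d65fc67ffa5efee581c67fa82fef7401557e6ba02e53bce502817ee03dad7bf502f70782c1ef7130173f028103341075e00b29⟩,
  ⟨!![1, 1, 1; 0, 1, 0; 0, 0, 1],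
    0x3f9ddffe33ee00023afd1a1ff353e2a4fd25bef58f799bf7ddfdca3fc7a08ff3f92ff79c4099a092d3f282f274bf96bfe62824fcffd8004b60e423b819f4b583e94fc42ff34e,
    0x228cf6857f07afd2c3fb4ef5dbc1b29f756feeb0f9c003e07fdaf41f7d040b823e7f178803c6ff97416b5f2d03ec940d5c01859f8fa412c2dd8100ba9f99a4157306be41b7f,
    0xd901a78002dfefa41b1100e1be95201637edd60156c011c0abec1ac3fc15c125f0c920130ffd4a4137efe483f22af7b002d5301437ece7fd5740c71097a413cb02193c4160d0580a8b055ffef14fcea3ef110e1effb69fea30002c0246fd81b029cc0741f1d6c02f10ab4feb9df0e700337fdfc4151802e27f5adfacf3c987f5e73fd7e0c133f85605727f8e3,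
    0x98bc019ac0993f36903a160212c01e6fd57fefb0034abff4100240263402ffbfc93f85600024fb97fface03bf3fda50111ff57ae637c0fb7fb5e81d450a42c08acfd1a82781f76580b6a⟩,
  ⟨!![1, 1, 1; 0, 1, 0; 0, 1, 1],
    0x3fe6d0017811b5ff97ff39a02628060bfd84c18e106437eed0fbab40801fbfd0239ced863df5d08a8be56df3b2ff29404a300dd0fea23fb170cb580f980c61804a9045c00949,
    0x809fff3d7fb3bf433c108ffff2012a202ffbf4710846fcdd70104435e9089bff1bef4e0c0fbefa427fe93,
    0x2fe80136bf340fda8803db0022c0bbb09c7c14e4069c4160afee7ffa4d00f33e220fd06bf3b8ff9bbdcf7fe2e7f19c036cff1dd03ec80aab0972413c00726bfd970dd1bf7d3ff90ff68c06f9809820a77806ee022c7e597fcf100e6400faff79bf049ff9e6fe7abd9bbffe000350f7ac7f4940bbb41c0d011efdf77ffd440ea5fdb7bf583,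
    0x5a00e97fca001413efe904747f97e049340eb8fd147ecc6ff2040afe019dbd8a602df801fffe96801c2f7ae7fc500422fff1bfe624030a0967413e4fab8bf426034c0032601cf7e13cedd17f1d4fe61412b6fe963fdc7fd1580a62ff17815d8f6c7c033b0381c00e1018dbf143fdeac3fd80209022211239bfeb0ef217f07103d87fdb6f991801e4fd0dc12bb⟩]

/-- A term `c • σ b` of a row of Fox derivatives. -/
structure FoxTerm where
  perm : Equiv.Perm (Fin 3)
  mat : Matrix (Fin 3) (Fin 3) ℤ
  coeff : ℤ

/-- The terms of `1 - E_{1,2}⁻¹`. -/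
def zeroTerms : List FoxTerm := [⟨1, 1, 1⟩, ⟨1, !![1, -1, 0; 0, 1, 0; 0, 0, 1], -1⟩]

/-- The Fox derivatives of `[E_{1,2}, E_{1,3}]`. -/
def rowTerms : List FoxTerm :=
  [⟨1, 1, 1⟩, ⟨1, !![1, 0, 1; 0, 1, 0; 0, 0, 1], -1⟩,
    ⟨Equiv.swap 1 2, !![1, 0, 1; 0, 1, 0; 0, 0, 1], 1⟩, ⟨Equiv.swap 1 2, 1, -1⟩]

/-- The Fox derivatives of `[E_{2,1}, E_{3,1}]`. -/
def columnTerms : List FoxTerm :=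
  [⟨Equiv.swap 0 1, 1, 1⟩, ⟨Equiv.swap 0 1, !![1, 0, 0; 0, 1, 0; 0, 1, 1], -1⟩,
    ⟨Equiv.swap 1 2 * Equiv.swap 0 1, !![1, 0, 0; 0, 1, 0; 0, 1, 1], 1⟩,
    ⟨Equiv.swap 1 2 * Equiv.swap 0 1, 1, -1⟩]

/-- The Fox derivatives of `[E_{1,2}, E_{2,3}] E_{1,3}⁻¹`. -/
def mixedTerms : List FoxTerm :=
  [⟨1, 1, 1⟩, ⟨1, !![1, 0, 1; 0, 1, 1; 0, 0, 1], -1⟩,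
    ⟨Equiv.swap 0 1 * Equiv.swap 1 2, !![1, 0, 0; 0, 1, 0; 1, 0, 1], 1⟩,
    ⟨Equiv.swap 0 1 * Equiv.swap 1 2, !![1, 0, 0; 0, 1, 0; 0, 1, 1], -1⟩,
    ⟨Equiv.swap 1 2, 1, -1⟩]

/-- The terms of `Mᴴ M` for the Fox derivatives `M`. -/
def squareTerms (l : List FoxTerm) (s : Equiv.Perm (Fin 3)) : List (ℕ × ℤ) :=
  l.flatMap fun x => l.map fun y =>
    (key x.mat s y.mat, if x.perm * s = y.perm then 2 ^ 36 * (x.coeff * y.coeff) else 0)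

/-- The terms of the square of the coboundary in degree zero. -/
def zeroSquareTerms (s : Equiv.Perm (Fin 3)) : List (ℕ × ℤ) :=
  zeroTerms.flatMap fun x => zeroTerms.map fun y =>
    (key x.mat s y.mat, 2 ^ 36 * (x.coeff * y.coeff))

/-- The terms of the Laplacian without the torsion relator, diminished by a scalar. -/
def laplacianTerms (s : Equiv.Perm (Fin 3)) : List (ℕ × ℤ) :=
  zeroSquareTerms s ++ (squareTerms rowTerms s ++ (squareTerms columnTerms s ++ (squareTerms mixedTerms s ++
    [(key 1 s 1, if s = 1 then -22794250433 else 0)])))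

theorem isSmall_gramVectors : ∀ v ∈ gramVectors, IsSmall v.mat := by decide +kernel

theorem isSmall_foxTerms :
    ∀ x ∈ zeroTerms ++ (rowTerms ++ (columnTerms ++ mixedTerms)), IsSmall x.mat := by
  decide +kernel

/-- The Gram matrix approximates the coefficients of the Laplacian at the permutation `s`. -/
def IsApproximate (s : Equiv.Perm (Fin 3)) : Prop :=
  PackedVector.isApproximation s gramVectors (laplacianTerms s) 130567249 = true

noncomputable instance : DecidablePred IsApproximate := fun _ => instDecidableEqBool _ _

theorem isApproximate_one : IsApproximate 1 := by decide +kernel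

theorem isApproximate_swap_zero_one : IsApproximate (Equiv.swap 0 1) := by decide +kernel

theorem isApproximate_swap_zero_two : IsApproximate (Equiv.swap 0 2) := by decide +kernel

theorem isApproximate_swap_one_two : IsApproximate (Equiv.swap 1 2) := by decide +kernel

theorem isApproximate_rotate : IsApproximate (Equiv.swap 0 1 * Equiv.swap 1 2) := by decide +kernel

theorem isApproximate_rotate_inv : IsApproximate (Equiv.swap 1 2 * Equiv.swap 0 1) := by decide +kernel

theorem isApproximate (s : Equiv.Perm (Fin 3)) : IsApproximate s := by
  have h : ∀ s : Equiv.Perm (Fin 3), s = 1 ∨ s = Equiv.swap 0 1 ∨ s = Equiv.swap 0 2 ∨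
      s = Equiv.swap 1 2 ∨ s = Equiv.swap 0 1 * Equiv.swap 1 2 ∨
      s = Equiv.swap 1 2 * Equiv.swap 0 1 := by decide +kernel
  rcases h s with h | h | h | h | h | h <;> rw [h]
  exacts [isApproximate_one, isApproximate_swap_zero_one, isApproximate_swap_zero_two,
    isApproximate_swap_one_two, isApproximate_rotate, isApproximate_rotate_inv]

/-! ## The Laplacian in terms of the unitary matrices -/

namespace IsSumOfHermitianSquares

theorem conjTranspose_eq {G n : Type*} [Group G] [Fintype n]
    {A : Matrix n n (MonoidAlgebra ℝ G)} (hA : IsSumOfHermitianSquares A) : Aᴴ = A := by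
  obtain ⟨k, M, rfl⟩ := hA
  simp [Matrix.conjTranspose_sum, Matrix.conjTranspose_mul]

end IsSumOfHermitianSquares

section Fox

variable {G S : Type*} [Group G] [DecidableEq S] (gen : S → G)

/-- The Fox derivative, mapped to the group ring of a group with given generators. -/
noncomputable def foxMap (s : S) (x : FreeGroup S) : MonoidAlgebra ℝ G :=
  MonoidAlgebra.mapDomainRingHom ℝ (FreeGroup.lift gen) (foxDeriv s x)

theorem foxMap_of (s t : S) : foxMap gen s (FreeGroup.of t) = if t = s then 1 else 0 := by
  rw [foxMap, foxDeriv_of]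
  split_ifs <;> simp

theorem foxMap_mul (s : S) (x y : FreeGroup S) :
    foxMap gen s (x * y) =
      foxMap gen s x + MonoidAlgebra.of ℝ G (FreeGroup.lift gen x) * foxMap gen s y := by
  rw [foxMap, foxDeriv_mul, map_add, map_mul]
  simp [foxMap]

theorem foxMap_inv (s : S) (x : FreeGroup S) :
    foxMap gen s x⁻¹ = -(MonoidAlgebra.of ℝ G (FreeGroup.lift gen x)⁻¹ * foxMap gen s x) := by
  have h := foxMap_mul gen s x⁻¹ x
  rw [inv_mul_cancel, map_inv] at h
  have h1 : foxMap gen s (1 : FreeGroup S) = 0 := by rw [foxMap, foxDeriv_one, map_zero]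
  rw [h1] at h
  exact eq_neg_of_add_eq_zero_left h.symm

theorem foxMap_commutator (s : S) (x y : FreeGroup S) (a b : G)
    (ha : FreeGroup.lift gen x = a) (hb : FreeGroup.lift gen y = b) :
    foxMap gen s ⁅x, y⁆ = foxMap gen s x - MonoidAlgebra.of ℝ G (a * b * a⁻¹) * foxMap gen s x +
      (MonoidAlgebra.of ℝ G a * foxMap gen s y - MonoidAlgebra.of ℝ G ⁅a, b⁆ * foxMap gen s y) := by
  subst ha hb
  simp only [commutatorElement_def, foxMap_mul, foxMap_inv, map_mul, map_inv, mul_neg,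
    ← mul_assoc]
  abel

end Fox

section Laplacian

/-- Permutations as ordered pairs of distinct indices. -/
noncomputable def permElementary : Equiv.Perm (Fin 3) ≃ ElementaryIndex :=
  Equiv.ofBijective (fun τ => ⟨(τ 0, τ 1), fun h => by simpa using τ.injective h⟩) (by decide +kernel)

/-- Permutations as ordered triples of distinct indices. -/
noncomputable def permTriple : Equiv.Perm (Fin 3) ≃ DistinctTriple :=
  Equiv.ofBijective (fun τ => ⟨(τ 0, τ 1, τ 2), fun h => by simpa using τ.injective h,
    fun h => by simpa using τ.injective h, fun h => by simpa using τ.injective h⟩)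
    (by decide +kernel)

theorem elementarySL3_permElementary (τ σ : Equiv.Perm (Fin 3)) :
    elementarySL3 (permElementary (τ * σ)) = permConj τ (elementarySL3 (permElementary σ)) := by
  have h : ∀ τ σ : Equiv.Perm (Fin 3), elementarySL3 ⟨((τ * σ) 0, (τ * σ) 1), fun h => by
      simpa using (τ * σ).injective h⟩ =
      permConj τ (elementarySL3 ⟨(σ 0, σ 1), fun h => by simpa using σ.injective h⟩) := by
    decide +kernel
  exact h τ σ

/-- The matrix given by a list of terms of Fox derivatives. -/
noncomputable def foxMatrix (l : List FoxTerm) : Matrix (Equiv.Perm (Fin 3)) (Equiv.Perm (Fin 3))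
      (MonoidAlgebra ℝ (Matrix.SpecialLinearGroup (Fin 3) ℤ)) :=
  (l.map fun x => (x.coeff : ℝ) • crossedUnit permConj
    (SemidirectProduct.inr x.perm * SemidirectProduct.inl (toSL x.mat))).sum

theorem foxMatrix_cons_apply (p : Equiv.Perm (Fin 3)) (m : Matrix (Fin 3) (Fin 3) ℤ) (c : ℤ) (l : List FoxTerm)
    (τ τ' : Equiv.Perm (Fin 3)) : foxMatrix (⟨p, m, c⟩ :: l) τ τ' =
      (c : ℝ) • (if permElementary (τ * p) = permElementary τ' then
        MonoidAlgebra.of ℝ _ (permConj τ (permConj p (toSL m))) else 0) +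
      foxMatrix l τ τ' := by
  rw [foxMatrix, List.map_cons, List.sum_cons, Matrix.add_apply, Matrix.smul_apply,
    crossedUnit_apply]
  simp only [SemidirectProduct.mul_right, SemidirectProduct.right_inr, SemidirectProduct.right_inl,
    mul_one, SemidirectProduct.mul_left, SemidirectProduct.left_inr, SemidirectProduct.left_inl,
    one_mul, EmbeddingLike.apply_eq_iff_eq, eq_comm (a := τ')]
  rfl

theorem toSL_one : toSL 1 = 1 := by
  simp [toSL]
  rfl

/-- The rows of Fox derivatives of commutators. -/
theorem foxMap_commutator_eq_foxMatrix (p q : Equiv.Perm (Fin 3)) (m₁ m₂ m₃ : Matrix (Fin 3) (Fin 3) ℤ)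
    (h₁ : permConj p (toSL m₁) = elementarySL3 (permElementary p) *
      elementarySL3 (permElementary q) * (elementarySL3 (permElementary p))⁻¹)
    (h₂ : permConj q (toSL m₂) = elementarySL3 (permElementary p))
    (h₃ : permConj q (toSL m₃) =
      ⁅elementarySL3 (permElementary p), elementarySL3 (permElementary q)⁆) (τ τ' : Equiv.Perm (Fin 3)) :
    foxMap elementarySL3 (permElementary τ') ⁅FreeGroup.of (permElementary (τ * p)),
      FreeGroup.of (permElementary (τ * q))⁆ =
    foxMatrix [⟨p, 1, 1⟩, ⟨p, m₁, -1⟩, ⟨q, m₂, 1⟩, ⟨q, m₃, -1⟩] τ τ' := by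
  rw [foxMap_commutator _ _ _ _ _ _ FreeGroup.lift_apply_of FreeGroup.lift_apply_of, foxMap_of,
    foxMap_of]
  simp only [foxMatrix_cons_apply, h₁, h₂, h₃, elementarySL3_permElementary, ← map_mul, ← map_inv,
    ← map_commutatorElement, toSL_one, map_one]
  simp only [foxMatrix, List.map_nil, List.sum_nil, Matrix.zero_apply, mul_ite, mul_one, mul_zero,
    Int.cast_one, one_smul, Int.cast_neg, neg_smul, sub_eq_add_neg, add_zero, add_assoc]

theorem toSL_of_isSmall {m : Matrix (Fin 3) (Fin 3) ℤ} (h : IsSmall m) :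
    toSL m = ⟨m, h.det_eq⟩ :=
  dif_pos h.det_eq

theorem foxMatrix_rowTerms (τ τ' : Equiv.Perm (Fin 3)) :
    foxMatrix rowTerms τ τ' = coboundaryOne elementarySL3 steinbergRelator
      (.row (permTriple τ)) (permElementary τ') := by
  refine (foxMap_commutator_eq_foxMatrix 1 (Equiv.swap 1 2) _ _ _ ?_ ?_ ?_ τ τ').symm
  all_goals
    rw [toSL_of_isSmall (by decide +kernel)]
    decide +kernel

theorem foxMatrix_columnTerms (τ τ' : Equiv.Perm (Fin 3)) :
    foxMatrix columnTerms τ τ' = coboundaryOne elementarySL3 steinbergRelator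
      (.column (permTriple τ)) (permElementary τ') := by
  refine (foxMap_commutator_eq_foxMatrix (Equiv.swap 0 1) (Equiv.swap 1 2 * Equiv.swap 0 1)
    _ _ _ ?_ ?_ ?_ τ τ').symm
  all_goals
    rw [toSL_of_isSmall (by decide +kernel)]
    decide +kernel

theorem foxMatrix_mixedTerms (τ τ' : Equiv.Perm (Fin 3)) :
    foxMatrix mixedTerms τ τ' = coboundaryOne elementarySL3 steinbergRelator
      (.mixed (permTriple τ)) (permElementary τ') := by
  have h := foxMap_commutator_eq_foxMatrix 1 (Equiv.swap 0 1 * Equiv.swap 1 2)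
    !![1, 0, 1; 0, 1, 1; 0, 0, 1] !![1, 0, 0; 0, 1, 0; 1, 0, 1] !![1, 0, 0; 0, 1, 0; 0, 1, 1]
    (by rw [toSL_of_isSmall (by decide +kernel)]; decide +kernel)
    (by rw [toSL_of_isSmall (by decide +kernel)]; decide +kernel)
    (by rw [toSL_of_isSmall (by decide +kernel)]; decide +kernel) τ τ'
  have hc : ⁅elementarySL3 (permElementary (τ * 1)),
      elementarySL3 (permElementary (τ * (Equiv.swap 0 1 * Equiv.swap 1 2)))⁆ *
      (elementarySL3 (permElementary (τ * Equiv.swap 1 2)))⁻¹ = 1 := by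
    simp only [elementarySL3_permElementary, ← map_commutatorElement, ← map_inv, ← map_mul]
    rw [show ⁅elementarySL3 (permElementary 1),
      permConj (Equiv.swap 0 1) (elementarySL3 (permElementary (Equiv.swap 1 2)))⁆ *
      (elementarySL3 (permElementary (Equiv.swap 1 2)))⁻¹ = 1 by decide +kernel, map_one]
  have h2 : coboundaryOne elementarySL3 steinbergRelator
      (.mixed (permTriple τ)) (permElementary τ') = foxMap elementarySL3 (permElementary τ')
      (⁅FreeGroup.of (permElementary (τ * 1)),
      FreeGroup.of (permElementary (τ * (Equiv.swap 0 1 * Equiv.swap 1 2)))⁆ *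
      (FreeGroup.of (permElementary (τ * Equiv.swap 1 2)))⁻¹) := rfl
  rw [h2, foxMap_mul, foxMap_inv, h, mul_neg, ← mul_assoc, ← map_mul, map_commutatorElement,
    FreeGroup.lift_apply_of, FreeGroup.lift_apply_of, FreeGroup.lift_apply_of, hc, foxMap_of,
    mixedTerms]
  simp only [foxMatrix_cons_apply, toSL_one, map_one, one_mul]
  split_ifs <;> simp [foxMatrix, add_assoc]

theorem List.sum_map_flatMap_map {I J K M : Type*} [AddCommMonoid M] (l : List I) (m : List J)
    (F : I → J → K) (g : K → M) :
    ((l.flatMap fun x => m.map (F x)).map g).sum =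
      (l.map fun x => (m.map fun y => g (F x y)).sum).sum := by
  induction l with
  | nil => rfl
  | cons x l ih => simp [ih, Function.comp_def]

theorem Finset.sum_list_sum_comm {I J M : Type*} [AddCommMonoid M] (t : Finset I) (l : List J)
    (f : I → J → M) : ∑ s ∈ t, (l.map (f s)).sum = (l.map fun x => ∑ s ∈ t, f s x).sum := by
  induction l with
  | nil => simp
  | cons x l ih => simp [Finset.sum_add_distrib, ih]

/-- The squares of Fox derivatives as lists of terms. -/
theorem sum_squareTerms (l : List FoxTerm) (hl : ∀ x ∈ l, IsSmall x.mat) :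
    ∑ s, ((squareTerms l s).map fun p => (p.2 : ℝ) • keyUnit s p.1).sum =
      (2 ^ 36 : ℝ) • ((foxMatrix l)ᴴ * foxMatrix l) := by
  simp only [squareTerms, List.sum_map_flatMap_map, Finset.sum_list_sum_comm]
  rw [foxMatrix, Matrix.conjTranspose_list_sum, List.map_map, ← List.sum_map_mul_right,
    List.smul_sum, List.map_map]
  congr 1
  refine List.map_congr_left fun x hx => ?_
  rw [Function.comp_apply, ← List.sum_map_mul_left, List.smul_sum, List.map_map]
  congr 1
  refine List.map_congr_left fun y hy => ?_
  rw [Finset.sum_eq_single (x.perm⁻¹ * y.perm)]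
  · rw [if_pos (mul_inv_cancel_left _ _), keyUnit_key (hl x hx) (hl y hy)]
    simp only [Function.comp_apply, Matrix.conjTranspose_smul, conjTranspose_crossedUnit,
      star_trivial, smul_mul_smul_comm, ← map_mul, smul_smul]
    congr 2
    · rw [Int.cast_mul, Int.cast_mul, Int.cast_pow, Int.cast_ofNat]
    · rw [sandwich]
      simp only [map_mul, map_inv, mul_inv_rev, mul_assoc]
  · intro s _ hs
    rw [if_neg fun h => hs (by rw [← h, inv_mul_cancel_left]), Int.cast_zero, zero_smul]
  · exact fun h => absurd (Finset.mem_univ _) h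

theorem IsSmall.toSL_eq {m : Matrix (Fin 3) (Fin 3) ℤ} (h : IsSmall m)
    {g : Matrix.SpecialLinearGroup (Fin 3) ℤ} (hg : m = g.1) : toSL m = g :=
  Subtype.ext (h.coe_toSL.trans hg)

theorem sum_zeroSquareTerms_apply (τ τ' : Equiv.Perm (Fin 3)) :
    (∑ s, (zeroTerms.map fun x => (zeroTerms.map fun y => ((x.coeff * y.coeff : ℤ) : ℝ) •
        crossedUnit permConj (sandwich permConj (toSL x.mat) s (toSL y.mat))).sum).sum) τ τ' =
      (coboundaryZero elementarySL3 * (coboundaryZero elementarySL3)ᴴ)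
        (permElementary τ) (permElementary τ') := by
  have h1 : toSL !![1, -1, 0; 0, 1, 0; 0, 0, 1] = (elementarySL3 (permElementary 1))⁻¹ :=
    IsSmall.toSL_eq (by decide +kernel) (by decide +kernel)
  rw [Matrix.sum_apply, Finset.sum_eq_single (τ⁻¹ * τ')]
  · have h3 := elementarySL3_permElementary τ 1
    have h4 := elementarySL3_permElementary τ' 1
    rw [mul_one] at h3 h4
    have h6 : ∀ x y : Matrix.SpecialLinearGroup (Fin 3) ℤ,
        crossedUnit permConj (sandwich permConj x (τ⁻¹ * τ') y) τ τ' =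
          MonoidAlgebra.of ℝ _ (permConj τ x)⁻¹ * MonoidAlgebra.of ℝ _ (permConj τ' y) := by
      intro x y
      rw [crossedUnit_apply, sandwich_eq, if_pos (mul_inv_cancel_left _ _).symm, ← map_mul,
        map_mul, ← MulAut.mul_apply, ← map_mul, mul_inv_cancel_left, map_inv]
    have h7 : (coboundaryZero elementarySL3 * (coboundaryZero elementarySL3)ᴴ)
        (permElementary τ) (permElementary τ') =
        (1 - MonoidAlgebra.of ℝ _ (permConj τ (elementarySL3 (permElementary 1)))) *
          (1 - MonoidAlgebra.of ℝ _ (permConj τ' (elementarySL3 (permElementary 1)))⁻¹) := by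
      rw [Matrix.mul_apply, Finset.univ_unique, Finset.sum_singleton, Matrix.conjTranspose_apply,
        coboundaryZero, Matrix.of_apply, Matrix.of_apply, star_sub, star_one,
        star_single_realGroupRing, h3, h4]
    rw [h7]
    generalize elementarySL3 (permElementary 1) = a at h1
    simp only [zeroTerms, List.map_cons, List.map_nil, List.sum_cons, List.sum_nil, add_zero,
      Matrix.add_apply, Matrix.smul_apply, h6, h1, toSL_one]
    rw [map_one, map_one, inv_one, map_one, map_inv (permConj τ), map_inv (permConj τ'), inv_inv,
      mul_one, one_mul, mul_sub, sub_mul, sub_mul]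
    simp only [one_mul, mul_one, mul_neg, neg_neg, Int.cast_one, Int.cast_neg, one_smul,
      neg_smul]
    abel
  · intro s _ hs
    have h5 : ∀ x y : Matrix.SpecialLinearGroup (Fin 3) ℤ,
        crossedUnit permConj (sandwich permConj x s y) τ τ' = 0 := by
      intro x y
      rw [crossedUnit_apply, sandwich_eq, if_neg]
      exact fun h => hs (by rw [h, inv_mul_cancel_left])
    simp [zeroTerms, h5]
  · exact fun h => absurd (Finset.mem_univ _) h

theorem sum_zeroSquareTerms :
    ∑ s, ((zeroSquareTerms s).map fun p => (p.2 : ℝ) • keyUnit s p.1).sum =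
      (2 ^ 36 : ℝ) • (coboundaryZero elementarySL3 * (coboundaryZero elementarySL3)ᴴ).submatrix
        permElementary permElementary := by
  have hl : ∀ x ∈ zeroTerms, IsSmall x.mat := fun x hx =>
    isSmall_foxTerms x (List.mem_append_left _ hx)
  rw [show (coboundaryZero elementarySL3 * (coboundaryZero elementarySL3)ᴴ).submatrix
    permElementary permElementary = _ from
    Matrix.ext fun τ τ' => (sum_zeroSquareTerms_apply τ τ').symm, Finset.smul_sum]
  refine Finset.sum_congr rfl fun s _ => ?_
  rw [zeroSquareTerms, List.sum_map_flatMap_map, List.smul_sum, List.map_map]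
  congr 1
  refine List.map_congr_left fun x hx => ?_
  rw [Function.comp_apply, List.smul_sum, List.map_map]
  congr 1
  refine List.map_congr_left fun y hy => ?_
  rw [Function.comp_apply, keyUnit_key (hl x hx) (hl y hy), smul_smul, Int.cast_mul,
    Int.cast_pow, Int.cast_ofNat]

end Laplacian

section Assembly

/-- The sum over the relators, with the triples of indices as permutations. -/
theorem sum_steinbergIndex {M : Type*} [AddCommMonoid M] (f : SteinbergIndex → M) :
    ∑ r, f r = ∑ τ, f (.row (permTriple τ)) + (∑ τ, f (.column (permTriple τ)) +
      (∑ τ, f (.mixed (permTriple τ)) + f .torsion)) := by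
  let e : DistinctTriple ⊕ DistinctTriple ⊕ DistinctTriple ⊕ Unit ≃ SteinbergIndex :=
    { toFun := Sum.elim .row (Sum.elim .column (Sum.elim .mixed fun _ => .torsion))
      invFun := fun r => match r with
        | .row t => .inl t
        | .column t => .inr (.inl t)
        | .mixed t => .inr (.inr (.inl t))
        | .torsion => .inr (.inr (.inr ()))
      left_inv := by rintro (t | t | t | t) <;> rfl
      right_inv := by rintro (t | t | t | _) <;> rfl }
  rw [← e.sum_comp f, Fintype.sum_sum_type, Fintype.sum_sum_type, Fintype.sum_sum_type]
  rw [permTriple.sum_comp fun t => f (.row t), permTriple.sum_comp fun t => f (.column t),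
    permTriple.sum_comp fun t => f (.mixed t), Fintype.sum_unique (ι := Unit)]
  rfl

/-- The row of Fox derivatives of the torsion relator. -/
noncomputable def torsionRow : Matrix Unit (Equiv.Perm (Fin 3))
    (MonoidAlgebra ℝ (Matrix.SpecialLinearGroup (Fin 3) ℤ)) :=
  Matrix.of fun _ τ => coboundaryOne elementarySL3 steinbergRelator .torsion (permElementary τ)

theorem coboundaryOne_submatrix :
    ((coboundaryOne elementarySL3 steinbergRelator)ᴴ *
      coboundaryOne elementarySL3 steinbergRelator).submatrix permElementary permElementary =
    (foxMatrix rowTerms)ᴴ * foxMatrix rowTerms + ((foxMatrix columnTerms)ᴴ * foxMatrix columnTerms +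
      ((foxMatrix mixedTerms)ᴴ * foxMatrix mixedTerms + torsionRowᴴ * torsionRow)) := by
  ext τ τ' : 1
  simp only [Matrix.submatrix_apply, Matrix.add_apply, Matrix.mul_apply,
    Matrix.conjTranspose_apply, foxMatrix_rowTerms, foxMatrix_columnTerms, foxMatrix_mixedTerms,
    sum_steinbergIndex, torsionRow, Matrix.of_apply, Finset.univ_unique, Finset.sum_singleton]

theorem steinbergLaplacian_submatrix :
    steinbergLaplacian.submatrix permElementary permElementary =
      (coboundaryZero elementarySL3 * (coboundaryZero elementarySL3)ᴴ).submatrix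
        permElementary permElementary +
      ((foxMatrix rowTerms)ᴴ * foxMatrix rowTerms +
        ((foxMatrix columnTerms)ᴴ * foxMatrix columnTerms +
          ((foxMatrix mixedTerms)ᴴ * foxMatrix mixedTerms + torsionRowᴴ * torsionRow))) := by
  rw [steinbergLaplacian, cohomologicalLaplacianOne, Matrix.submatrix_add, ← coboundaryOne_submatrix]
  rfl

theorem conjTranspose_steinbergLaplacian : steinbergLaplacianᴴ = steinbergLaplacian := by
  simp [steinbergLaplacian, cohomologicalLaplacianOne, Matrix.conjTranspose_mul]

theorem sum_laplacianTerms :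
    ∑ s, ((laplacianTerms s).map fun p => (p.2 : ℝ) • keyUnit s p.1).sum =
      (2 ^ 36 : ℝ) • (steinbergLaplacian.submatrix permElementary permElementary -
        torsionRowᴴ * torsionRow) - (22794250433 : ℝ) • 1 := by
  have h1 : ∀ s, (([(key 1 s 1, if s = 1 then -22794250433 else 0)] : List (ℕ × ℤ)).map
      fun p => (p.2 : ℝ) • keyUnit s p.1).sum =
      if s = 1 then -((22794250433 : ℝ) • 1) else 0 := by
    intro s
    rw [List.map_singleton, List.sum_singleton]
    split_ifs with hs
    · subst hs
      have h2 : IsSmall 1 := by decide +kernel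
      rw [keyUnit_key h2 h2, sandwich_eq, toSL_one, inv_one, map_one, one_mul]
      rw [show (⟨1, 1⟩ : Matrix.SpecialLinearGroup (Fin 3) ℤ ⋊[permConj] Equiv.Perm (Fin 3)) = 1
        from rfl, map_one]
      simp
    · simp
  have hs : ∀ x, x ∈ rowTerms ∨ x ∈ columnTerms ∨ x ∈ mixedTerms → IsSmall x.mat := by
    intro x hx
    refine isSmall_foxTerms x (List.mem_append_right _ ?_)
    rwa [List.mem_append, List.mem_append]
  simp only [laplacianTerms, List.map_append, List.sum_append, Finset.sum_add_distrib, h1]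
  rw [sum_zeroSquareTerms, sum_squareTerms _ fun x hx => hs x (Or.inl hx),
    sum_squareTerms _ fun x hx => hs x (Or.inr (Or.inl hx)),
    sum_squareTerms _ fun x hx => hs x (Or.inr (Or.inr hx)),
    Finset.sum_ite_eq' Finset.univ 1, if_pos (Finset.mem_univ _), steinbergLaplacian_submatrix]
  module

theorem isSumOfHermitianSquares_submatrix :
    IsSumOfHermitianSquares ((steinbergLaplacian - (0.32 : ℝ) •
      (1 : Matrix ElementaryIndex ElementaryIndex
        (MonoidAlgebra ℝ (Matrix.SpecialLinearGroup (Fin 3) ℤ)))).submatrix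
          permElementary permElementary) := by
  choose t ht hW using fun s => PackedVector.exists_of_isApproximation isSmall_gramVectors
    (isApproximate s)
  have hP := GramVector.isSumOfHermitianSquares_pairing gramVectors
  have hT := IsSumOfHermitianSquares.conjTranspose_mul_self_of_rect torsionRow
  have hone := IsSumOfHermitianSquares.conjTranspose_mul_self
    (1 : Matrix (Equiv.Perm (Fin 3)) (Equiv.Perm (Fin 3))
      (MonoidAlgebra ℝ (Matrix.SpecialLinearGroup (Fin 3) ℤ)))
  rw [Matrix.conjTranspose_one, mul_one] at hone
  have hsum : ∑ s, (t s).eval (keyUnit s) = _ :=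
    (Finset.sum_congr rfl fun s _ => hW s).trans (Finset.sum_sub_distrib _ _)
  rw [sum_laplacianTerms] at hsum
  have hnorm : IsSumOfHermitianSquares (∑ s, ((t s).eval (keyUnit s) +
      ((t s).eval (keyUnit s))ᴴ + (2 * (130567249 : ℝ)) • 1)) := by
    refine .sum _ fun s _ => ?_
    have h := ((t s).isSumOfHermitianSquares_eval_add_norm (keyUnit s)
      (conjTranspose_keyUnit_mul_self s)).add
      (hone.smul (c := 2 * ((130567249 : ℝ) - (t s).norm))
        (mul_nonneg zero_le_two (sub_nonneg.2 (by exact_mod_cast ht s))))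
    convert h using 1
    module
  rw [Finset.sum_add_distrib, Finset.sum_add_distrib, ← Matrix.conjTranspose_sum, hsum,
    Finset.sum_const, Finset.card_univ, Fintype.card_perm, Fintype.card_fin,
    Matrix.conjTranspose_sub, Matrix.conjTranspose_sub, Matrix.conjTranspose_smul,
    Matrix.conjTranspose_smul, Matrix.conjTranspose_sub, hT.conjTranspose_eq, hP.conjTranspose_eq,
    Matrix.conjTranspose_submatrix, conjTranspose_steinbergLaplacian, Matrix.conjTranspose_one,
    star_trivial, star_trivial, show Nat.factorial 3 = 6 from rfl] at hnorm
  have h := (((hnorm.smul (c := 1 / 2 ^ 37) (by positivity)).add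
    (hP.smul (c := 1 / 2 ^ 36) (by positivity))).add hT).add
    (hone.smul (c := 22794250433 / 2 ^ 36 - 6 * 130567249 / 2 ^ 36 - 0.32) (by norm_num))
  convert h using 1
  rw [Matrix.submatrix_sub, Matrix.submatrix_smul, Pi.sub_apply, Pi.sub_apply, Pi.smul_apply,
    Pi.smul_apply, Matrix.submatrix_one_equiv]
  module

end Assembly

theorem mainTheorem2 :
    IsSumOfHermitianSquares
      (steinbergLaplacian -
        (0.32 : ℝ) • (1 : Matrix ElementaryIndex ElementaryIndex
          (MonoidAlgebra ℝ (Matrix.SpecialLinearGroup (Fin 3) ℤ)))) := by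
  have h := isSumOfHermitianSquares_submatrix.submatrix permElementary.symm
  rwa [Matrix.submatrix_submatrix, Equiv.self_comp_symm, Matrix.submatrix_id_id] at h
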